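/- An NFA $N$ over an alphabet $\Sigma$ has a finite set of states, an initial state (or a set of initial states), a set of accepting states and transitions that each read one letter. For a word $x$ let $\mathrm{ambig}_N(x)$ be the number of accepting computations of $N$ on $x$, that is, of state sequences that start in an initial state, follow transitions reading $x$, and end in an accepting state; put $\mathrm{ambig}_N(n)=\max\{\mathrm{ambig}_N(x) : x\in\Sigma^n\}$. $N$ has sublinear (linear) ambiguity if $\mathrm{ambig}_N(n)=o(n)$ (respectively $O(n)$) as $n\to\infty$, and $N$ is finitely ambiguous if $\mathrm{ambig}_N(n)$ is bounded by a constant. For an integer $r\ge 1$ let $\Sigma_r$ be the alphabet of all subsets of size $r$ of $\{1,\dots,r^{32}\}$, let $L_r=\{xy : x,y\in\Sigma_r,\ x\cap y\neq\emptyset\}$, and let $L=(L_r)^t$, where $t$ is $r^{1/3}$, rounded up or down to an integer if necessary. All words of $L$ have length $2t$. Let $\exists_1(L)$ be the language of all words $w_1w_2\cdots w_m$, $m\in\mathbb{N}$, with blocks $w_i\in\Sigma_r^{2t}$ such that $w_i\in L$ for at least one $i$. (1) Any NFA with sublinear ambiguity, and in particular any finitely ambiguous NFA, recognizing $\exists_1(L)$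 has at least $2^{\Omega(r^{1/3})}$ states: there is a constant $c>0$ such that for all $r\ge 1$ every such NFA has at least $2^{c\,r^{1/3}}$ states. (2) There is a polynomial bound $C r^d$, with constants $C,d$ independent of $r$, such that for all $r\ge 1$ the language $\exists_1(L)$ is recognized by an NFA with a single initial state, at most $C r^d$ states and linear ambiguity $O(n)$ (the constant in $O(n)$ may depend on $r$). Together, (1) and (2) separate finitely ambiguous from polynomially ambiguous NFAs. -/

import Mathlib

open Filter Asymptotics

/-- The alphabet `Σ_r`: the subsets of size `r` of a set with `r ^ 32` elements. -/
abbrev SubsetLetter (r : ℕ) : Type :=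
  {s : Finset (Fin (r ^ 32)) // s.card = r}

/-- The language `L_r` of the two-letter words `xy` with `x ∩ y ≠ ∅`. -/
def nonDisj (r : ℕ) : Language (SubsetLetter r) :=
  {w | ∃ x y : SubsetLetter r, w = [x, y] ∧ x.1 ∩ y.1 ≠ ∅}

/-- For a language `L` of words of length `ℓ`, the language `∃₁(L)` of the words `w₁ w₂ ⋯ wₘ`,
`m ∈ ℕ`, that are partitioned into blocks `wᵢ` of length `ℓ`, at least one of which is in `L`. -/
def existsOne {α : Type*} (ℓ : ℕ) (L : Language α) : Language α :=
  {w | ∃ bs : List (List α), w = bs.flatten ∧ (∀ b ∈ bs, b.length = ℓ) ∧ ∃ b ∈ bs, b ∈ L}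

namespace NFA

variable {α σ : Type*}

/-- The sequence of states `ρ 0, …, ρ |x|` is an accepting computation of `N` on the word `x`. -/
def IsAcceptingRun (N : NFA α σ) (x : List α) (ρ : Fin (x.length + 1) → σ) : Prop :=
  ρ 0 ∈ N.start ∧ (∀ i : Fin x.length, ρ i.succ ∈ N.step (ρ i.castSucc) (x.get i)) ∧
    ρ (Fin.last x.length) ∈ N.accept

/-- `ambig_N(x)`: the number of accepting computations of `N` on the word `x`. -/
noncomputable def ambigWord (N : NFA α σ) (x : List α) : ℕ :=
  Nat.card {ρ : Fin (x.length + 1) → σ // N.IsAcceptingRun x ρ}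

/-- `ambig_N(n)`: the maximum of `ambig_N(x)` over all words `x` of length `n`. For a finite state
set the values are bounded by `|σ| ^ (n + 1)`, so that the supremum is a maximum (and it is `0`
if there is no word of length `n`). -/
noncomputable def ambig (N : NFA α σ) (n : ℕ) : ℕ :=
  sSup (N.ambigWord '' {x : List α | x.length = n})

/-- The ambiguity of `N` is `o(n)`. -/
def HasSublinearAmbiguity (N : NFA α σ) : Prop :=
  (fun n : ℕ => (N.ambig n : ℝ)) =o[atTop] (fun n : ℕ => (n : ℝ))

/-- The ambiguity of `N` is `O(n)`. -/
def HasLinearAmbiguity (N : NFA α σ) : Prop :=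
  (fun n : ℕ => (N.ambig n : ℝ)) =O[atTop] (fun n : ℕ => (n : ℝ))

/-- `N` is finitely ambiguous: its ambiguity is bounded by a constant. -/
def IsFinitelyAmbiguous (N : NFA α σ) : Prop :=
  ∃ B : ℕ, ∀ n : ℕ, N.ambig n ≤ B

end NFA

/-! Lower bound, first half. Let `Z` be the monoid of concatenations of blocks outside `L`, and
count runs by matrices over `ℕ`. Choose `z` in `Z` whose matrix has idempotent support and as few
looping useful states as possible. Minimality makes every `z * u * z` with `u` in `Z` act on these
loops as a permutation, and these permutations form a group `H`. Let the orbit trace of `w` count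
the runs on `z * w * z` between loops in a common orbit of `H`; for `w` in `Z` it is the number `k`
of loops. If `w` is a block in `L`, then `z * w * z` is accepted although no word of `Z` is, so some
run crosses from one orbit to another. Were the trace still at least `k`, inserting suitable
elements of `H` between copies of `w` would produce linearly many runs. So sublinear ambiguity
yields a nonnegative combination `f` of run counts that is `k` on the blocks outside `L` and less
than `k` on those in `L` (`SlowRep.orbitTrace_lt_card`, `NFA.exists_separating_weights`).

Second half. On letters that are graphs of functions there are a distribution on the intersecting
pairs and a measure on the disjoint pairs such that the first minus 1/16 of the second is
nonnegative on large rectangles and has total mass at most 31/32 (`hardPair`). The runs on a pair of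
letters are a sum of rectangles, one for each middle state, so up to rare transitions the `t`-fold
product of this signed measure gives `f` a nonnegative integral. The integral of `k - f` is
therefore at most about `k (31/32)^t`. It is also at least 1, because `k - f` vanishes on the blocks
outside `L` and is at least 1 on `L`, where the product is a probability distribution. So `k`, and
with it the number of states, is exponential in `t` (`HardPair.one_le_of_separating`).

Upper bound. `guessNFA` guesses a block and a common element of each of its pairs. On words of
length `n` this leaves at most `n` choices of the block and `r^(32 t)` choices of elements. -/

/-! ### Run counts as matrix products. -/

namespace NFA

variable {α σ : Type*}

open Classical in
/-- The `0`-`1` matrix of the transitions of `N` that read the letter `a`. -/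
noncomputable def stepMatrix (N : NFA α σ) (a : α) : Matrix σ σ ℕ :=
  Matrix.of fun p q => if q ∈ N.step p a then 1 else 0

/-- The matrix whose entry at `(p, q)` is the number of computations from `p` to `q` on `x`. -/
noncomputable def runMatrix [Fintype σ] [DecidableEq σ] (N : NFA α σ) (x : List α) :
    Matrix σ σ ℕ :=
  (x.map N.stepMatrix).prod

variable [Fintype σ] [DecidableEq σ]

@[simp] theorem runMatrix_nil (N : NFA α σ) : N.runMatrix [] = 1 := by simp [runMatrix]

theorem runMatrix_cons (N : NFA α σ) (a : α) (x : List α) :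
    N.runMatrix (a :: x) = N.stepMatrix a * N.runMatrix x := by simp [runMatrix]

omit [Fintype σ] [DecidableEq σ] in
theorem stepMatrix_pos {N : NFA α σ} {a : α} {p q : σ} :
    0 < N.stepMatrix a p q ↔ q ∈ N.step p a := by
  simp only [stepMatrix, Matrix.of_apply]
  split_ifs <;> simp_all

/-- Arbitrary initial weights `g` make the induction work: the transition on the first letter is
absorbed into them. -/
theorem sum_runs_eq (N : NFA α σ) (x : List α) (g f : σ → ℕ) :
    ∑ ρ : Fin (x.length + 1) → σ, g (ρ 0) *
        (∏ i : Fin x.length, N.stepMatrix (x.get i) (ρ i.castSucc) (ρ i.succ)) *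
          f (ρ (Fin.last _)) =
      ∑ p, g p * ∑ q, N.runMatrix x p q * f q := by
  induction x generalizing g with
  | nil =>
    refine ((Equiv.funUnique (Fin 1) σ).symm.sum_comp _).symm.trans ?_
    simp [Matrix.one_apply]
  | cons a x ih =>
    refine ((Fin.consEquiv fun _ : Fin (x.length + 1 + 1) => σ).sum_comp _).symm.trans ?_
    rw [Fintype.sum_prod_type]
    refine Finset.sum_congr rfl fun p _ => ?_
    have h := ih (fun q => g p * N.stepMatrix a p q)
    simp only [runMatrix_cons, Matrix.mul_apply]
    calc _ = ∑ ρ : Fin (x.length + 1) → σ, g p * N.stepMatrix a p (ρ 0) *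
        (∏ i : Fin x.length, N.stepMatrix (x.get i) (ρ i.castSucc) (ρ i.succ)) *
          f (ρ (Fin.last _)) := by
          refine Finset.sum_congr rfl fun ρ _ => ?_
          have : (∏ i : Fin (a :: x).length, N.stepMatrix ((a :: x).get i)
              ((Fin.cons p ρ : Fin (x.length + 2) → σ) i.castSucc)
              ((Fin.cons p ρ : Fin (x.length + 2) → σ) i.succ)) = N.stepMatrix a p (ρ 0) *
              ∏ i : Fin x.length, N.stepMatrix (x.get i) (ρ i.castSucc) (ρ i.succ) := by
            exact (Fin.prod_univ_succ (n := x.length) _).trans rfl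
          change g p * (∏ i : Fin (a :: x).length, N.stepMatrix ((a :: x).get i)
              ((Fin.cons p ρ : Fin (x.length + 2) → σ) i.castSucc)
              ((Fin.cons p ρ : Fin (x.length + 2) → σ) i.succ)) * f (ρ (Fin.last _)) = _
          rw [this]
          ring
      _ = _ := by
          rw [h]
          simp only [Finset.mul_sum, Finset.sum_mul]
          rw [Finset.sum_comm]
          refine Finset.sum_congr rfl fun q _ => Finset.sum_congr rfl fun r _ => ?_
          ring

open Classical in
theorem ambigWord_eq_sum (N : NFA α σ) (x : List α) :
    N.ambigWord x = ∑ p, (if p ∈ N.start then 1 else 0) *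
      ∑ q, N.runMatrix x p q * (if q ∈ N.accept then 1 else 0) := by
  rw [← sum_runs_eq, ambigWord, Nat.card_eq_fintype_card, Fintype.card_subtype,
    Finset.card_filter]
  refine Finset.sum_congr rfl fun ρ _ => ?_
  have h : (∏ i : Fin x.length, N.stepMatrix (x.get i) (ρ i.castSucc) (ρ i.succ)) =
      if ∀ i : Fin x.length, ρ i.succ ∈ N.step (ρ i.castSucc) (x.get i) then 1 else 0 := by
    split_ifs with h
    · exact Finset.prod_eq_one fun i _ => if_pos (h i)
    · push Not at h
      obtain ⟨i, hi⟩ := h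
      exact Finset.prod_eq_zero (Finset.mem_univ i) (if_neg hi)
  rw [h]
  unfold IsAcceptingRun
  split_ifs <;> simp_all

theorem runMatrix_le_ambigWord (N : NFA α σ) (x : List α) {p q : σ} (hp : p ∈ N.start)
    (hq : q ∈ N.accept) : N.runMatrix x p q ≤ N.ambigWord x := by
  classical
  rw [ambigWord_eq_sum]
  refine le_trans ?_ (Finset.single_le_sum (fun _ _ => Nat.zero_le _) (Finset.mem_univ p))
  simp only [hp, if_true, one_mul]
  refine le_trans ?_ (Finset.single_le_sum (fun _ _ => Nat.zero_le _) (Finset.mem_univ q))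
  simp [hq]

-- Boundedness matters for `ambig`, since in `ℕ` the supremum of an unbounded set is `0`.
omit [DecidableEq σ] in
theorem ambigWord_le_card_pow (N : NFA α σ) (x : List α) :
    N.ambigWord x ≤ Fintype.card σ ^ (x.length + 1) := by
  classical
  rw [ambigWord, Nat.card_eq_fintype_card]
  exact (Fintype.card_subtype_le _).trans (by simp)

omit [DecidableEq σ] in
theorem ambigWord_le_ambig (N : NFA α σ) (x : List α) : N.ambigWord x ≤ N.ambig x.length := by
  refine le_csSup ⟨Fintype.card σ ^ (x.length + 1), ?_⟩ ⟨x, rfl, rfl⟩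
  rintro _ ⟨y, hy, rfl⟩
  rw [← (show y.length = x.length from hy)]
  exact N.ambigWord_le_card_pow y

theorem runMatrix_pos_iff {N : NFA α σ} {x : List α} {p q : σ} :
    0 < N.runMatrix x p q ↔ q ∈ N.evalFrom {p} x := by
  induction x generalizing p with
  | nil => simp [Matrix.one_apply, eq_comm]; split_ifs <;> simp_all
  | cons a x ih =>
    rw [runMatrix_cons, Matrix.mul_apply, evalFrom_cons, stepSet_singleton,
      evalFrom_eq_biUnion_singleton]
    simp only [Set.mem_iUnion, ← ih, pos_iff_ne_zero, ne_eq, Finset.sum_eq_zero_iff, not_forall,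
      Nat.mul_eq_zero, not_or]
    simp [← pos_iff_ne_zero, stepMatrix_pos]

theorem mem_accepts_iff_runMatrix {N : NFA α σ} {x : List α} :
    x ∈ N.accepts ↔ ∃ p ∈ N.start, ∃ q ∈ N.accept, 0 < N.runMatrix x p q := by
  rw [mem_accepts, evalFrom_eq_biUnion_singleton]
  simp only [Set.mem_iUnion, runMatrix_pos_iff]
  constructor
  · rintro ⟨q, hq, p, hp, h⟩
    exact ⟨p, hp, q, hq, h⟩
  · rintro ⟨p, hp, q, hq, h⟩
    exact ⟨q, hq, p, hp, h⟩

omit [Fintype σ] [DecidableEq σ] in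
theorem IsFinitelyAmbiguous.hasSublinearAmbiguity {N : NFA α σ} (h : N.IsFinitelyAmbiguous) :
    N.HasSublinearAmbiguity := by
  obtain ⟨B, hB⟩ := h
  have : (fun n : ℕ => (N.ambig n : ℝ)) =O[atTop] (fun _ => (1 : ℝ)) := by
    refine IsBigO.of_bound B (Eventually.of_forall fun n => ?_)
    simpa using hB n
  refine this.trans_isLittleO ?_
  rw [isLittleO_const_left]
  right
  exact (tendsto_norm_atTop_atTop.comp tendsto_natCast_atTop_atTop)

-- The finitely many lengths at which the asymptotic estimate fails are absorbed into the constant.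
omit [Fintype σ] [DecidableEq σ] in
theorem HasSublinearAmbiguity.exists_bound {N : NFA α σ} (h : N.HasSublinearAmbiguity) {δ : ℝ}
    (hδ : 0 < δ) : ∃ B : ℝ, ∀ n : ℕ, (N.ambig n : ℝ) ≤ δ * n + B := by
  obtain ⟨n₀, hn₀⟩ := eventually_atTop.1 (h.def hδ)
  refine ⟨∑ n ∈ Finset.range n₀, (N.ambig n : ℝ), fun n => ?_⟩
  have hs : 0 ≤ ∑ n ∈ Finset.range n₀, (N.ambig n : ℝ) :=
    Finset.sum_nonneg fun _ _ => Nat.cast_nonneg _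
  rcases lt_or_ge n n₀ with hn | hn
  · have := Finset.single_le_sum (f := fun n => (N.ambig n : ℝ)) (fun _ _ => Nat.cast_nonneg _)
      (Finset.mem_range.2 hn)
    have h2 : 0 ≤ δ * (n : ℝ) := by positivity
    linarith
  · have := hn₀ n hn
    simp only [Real.norm_natCast] at this
    linarith

end NFA

/-! ### Renaming states, and upper bounds on ambiguity. -/

namespace NFA

section Transport

variable {α σ τ : Type*}

/-- The automaton `N` with its states renamed along `e`. -/
def mapEquiv (N : NFA α σ) (e : σ ≃ τ) : NFA α τ where
  step q a := e.symm ⁻¹' N.step (e.symm q) a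
  start := e.symm ⁻¹' N.start
  accept := e.symm ⁻¹' N.accept

variable [Fintype σ] [DecidableEq σ] [Fintype τ] [DecidableEq τ]

theorem runMatrix_mapEquiv (N : NFA α σ) (e : σ ≃ τ) (x : List α) :
    (N.mapEquiv e).runMatrix x = (N.runMatrix x).submatrix e.symm e.symm := by
  induction x with
  | nil => simp
  | cons a x ih =>
    rw [runMatrix_cons, ih, runMatrix_cons, ← Matrix.submatrix_mul_equiv _ _ _ e.symm]
    congr 1

theorem accepts_mapEquiv (N : NFA α σ) (e : σ ≃ τ) : (N.mapEquiv e).accepts = N.accepts := by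
  ext x
  rw [mem_accepts_iff_runMatrix, mem_accepts_iff_runMatrix]
  constructor
  · rintro ⟨p, hp, q, hq, h⟩
    exact ⟨e.symm p, hp, e.symm q, hq, by rwa [runMatrix_mapEquiv] at h⟩
  · rintro ⟨p, hp, q, hq, h⟩
    exact ⟨e p, by simpa [mapEquiv] using hp, e q, by simpa [mapEquiv] using hq,
      by simpa [runMatrix_mapEquiv] using h⟩

theorem ambigWord_mapEquiv (N : NFA α σ) (e : σ ≃ τ) (x : List α) :
    (N.mapEquiv e).ambigWord x = N.ambigWord x := by
  classical
  rw [ambigWord_eq_sum, ambigWord_eq_sum, ← e.sum_comp]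
  refine Finset.sum_congr rfl fun p _ => ?_
  rw [← e.sum_comp, runMatrix_mapEquiv]
  simp [mapEquiv]

end Transport

variable {α σ : Type*}

theorem cons_mem_acceptsFrom_singleton {N : NFA α σ} {q : σ} {a : α} {w : List α} :
    a :: w ∈ N.acceptsFrom {q} ↔ ∃ q' ∈ N.step q a, w ∈ N.acceptsFrom {q'} := by
  rw [cons_mem_acceptsFrom, stepSet_singleton, mem_acceptsFrom, evalFrom_eq_biUnion_singleton]
  simp only [Set.mem_iUnion, mem_acceptsFrom]
  constructor
  · rintro ⟨s, hs, q', hq', h⟩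
    exact ⟨q', hq', s, hs, h⟩
  · rintro ⟨q', hq', s, hs, h⟩
    exact ⟨s, hs, q', hq', h⟩

open Classical in
/-- A potential that does not increase along the transitions bounds the number of accepting
computations. -/
theorem ambigWord_le_of_potential [Fintype σ] (N : NFA α σ) (V : ℕ → σ → ℕ) (q₀ : σ)
    (hstart : N.start = {q₀}) (hacc : ∀ q ∈ N.accept, 1 ≤ V 0 q)
    (hstep : ∀ n q a, ∑ q', N.stepMatrix a q q' * V n q' ≤ V (n + 1) q) (x : List α) :
    N.ambigWord x ≤ V x.length q₀ := by
  have key : ∀ (x : List α) (q : σ),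
      ∑ q', N.runMatrix x q q' * (if q' ∈ N.accept then 1 else 0) ≤ V x.length q := by
    intro x
    induction x with
    | nil =>
      intro q
      simp only [runMatrix_nil, Matrix.one_apply, List.length_nil]
      simp only [ite_mul, one_mul, zero_mul, Finset.sum_ite_eq, Finset.mem_univ, if_true]
      split_ifs with h
      · exact hacc q h
      · exact Nat.zero_le _
    | cons a x ih =>
      intro q
      refine le_trans (le_of_eq ?_) ((Finset.sum_le_sum fun q' _ =>
        Nat.mul_le_mul_left (N.stepMatrix a q q') (ih q')).trans (hstep x.length q a))
      simp only [runMatrix_cons, Matrix.mul_apply, Finset.sum_mul, Finset.mul_sum]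
      rw [Finset.sum_comm]
      exact Finset.sum_congr rfl fun _ _ => Finset.sum_congr rfl fun _ _ => by ring
  rw [ambigWord_eq_sum]
  simpa [hstart] using key x q₀

theorem sum_stepMatrix_mul_le [Fintype σ] (N : NFA α σ) {q : σ} {a : α} (F : Finset σ)
    (hF : N.step q a ⊆ F) (V : σ → ℕ) : ∑ q', N.stepMatrix a q q' * V q' ≤ ∑ q' ∈ F, V q' := by
  classical
  rw [← Finset.sum_subset (Finset.subset_univ F)]
  · refine Finset.sum_le_sum fun q' _ => ?_
    simp only [stepMatrix, Matrix.of_apply]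
    split_ifs <;> simp
  · intro q' _ hq'
    have : q' ∉ N.step q a := fun h => hq' (hF h)
    simp [stepMatrix, this]

theorem hasLinearAmbiguity_of_le (N : NFA α σ) (K : ℕ)
    (h : ∀ x : List α, N.ambigWord x ≤ x.length * K) : N.HasLinearAmbiguity := by
  refine IsBigO.of_bound K (Eventually.of_forall fun n => ?_)
  simp only [Real.norm_natCast]
  have : N.ambig n ≤ n * K := by
    refine csSup_le' ?_
    rintro _ ⟨x, hx, rfl⟩
    rw [← (show x.length = n from hx)]
    exact h x
  calc (N.ambig n : ℝ) ≤ ((n * K : ℕ) : ℝ) := by exact_mod_cast this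
    _ = K * n := by push_cast; ring

end NFA

/-! ### The guessing automaton of linear ambiguity. -/

section Guess

variable {A U : Type*}

/-- The words `xy` such that some `u` is in relation with both letters. -/
def commonPairs (mem : U → A → Prop) : Language A :=
  {w | ∃ x y u, w = [x, y] ∧ mem u x ∧ mem u y}

theorem length_of_mem_commonPairs_pow {mem : U → A → Prop} {n : ℕ} {w : List A}
    (h : w ∈ commonPairs mem ^ n) : w.length = 2 * n := by
  induction n generalizing w with
  | zero =>
    rw [pow_zero, Language.mem_one] at h
    simp [h]
  | succ n ih =>
    rw [pow_succ', Language.mem_mul] at h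
    obtain ⟨a, ⟨x, y, u, rfl, -, -⟩, b, hb, rfl⟩ := h
    rw [List.length_append, ih hb]
    simp only [List.length_cons, List.length_nil]
    ring

theorem exists_flatten_of_dvd_length {ℓ : ℕ} {v : List A} (h : ℓ ∣ v.length) :
    ∃ bs : List (List A), v = bs.flatten ∧ ∀ b ∈ bs, b.length = ℓ := by
  obtain ⟨n, hn⟩ := h
  induction n generalizing v with
  | zero => exact ⟨[], by simpa using hn, by simp⟩
  | succ n ih =>
    obtain ⟨bs, h1, h2⟩ := ih (v := v.drop ℓ) (by rw [List.length_drop, hn, mul_add]; simp)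
    refine ⟨v.take ℓ :: bs, by rw [List.flatten_cons, ← h1, List.take_append_drop], ?_⟩
    intro b hb
    rcases List.mem_cons.1 hb with rfl | hb
    · rw [List.length_take, hn, mul_add, mul_one]
      exact min_eq_left (Nat.le_add_left _ _)
    · exact h2 b hb

theorem length_flatten_of_forall {ℓ : ℕ} {bs : List (List A)} (h : ∀ b ∈ bs, b.length = ℓ) :
    bs.flatten.length = bs.length * ℓ := by
  induction bs with
  | nil => simp
  | cons b bs ih =>
    rw [List.flatten_cons, List.length_append, h b (by simp),
      ih fun b hb => h b (List.mem_cons_of_mem _ hb), List.length_cons]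
    ring

/-- Outside the chosen block only lengths modulo `ℓ` matter, and these an automaton can track. -/
theorem mem_existsOne_iff {ℓ : ℕ} {L : Language A} (hL : ∀ b ∈ L, b.length = ℓ) {w : List A} :
    w ∈ existsOne ℓ L ↔ ∃ u v x, w = u ++ (v ++ x) ∧ ℓ ∣ u.length ∧ v ∈ L ∧ ℓ ∣ x.length := by
  constructor
  · rintro ⟨bs, rfl, hlen, b, hb, hbL⟩
    obtain ⟨l, r, rfl⟩ := List.append_of_mem hb
    refine ⟨l.flatten, b, r.flatten, by simp, ?_, hbL, ?_⟩
    · rw [length_flatten_of_forall fun b hb => hlen b (by simp [hb])]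
      exact dvd_mul_left _ _
    · rw [length_flatten_of_forall fun b hb => hlen b (by simp [hb])]
      exact dvd_mul_left _ _
  · rintro ⟨u, v, x, rfl, hu, hv, hx⟩
    obtain ⟨bs, rfl, hbs⟩ := exists_flatten_of_dvd_length hu
    obtain ⟨cs, rfl, hcs⟩ := exists_flatten_of_dvd_length hx
    refine ⟨bs ++ v :: cs, by simp, ?_, v, by simp, hv⟩
    intro b hb
    rcases List.mem_append.1 hb with hb | hb
    · exact hbs b hb
    · rcases List.mem_cons.1 hb with rfl | hb
      · exact hL _ hv
      · exact hcs b hb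

/-- The states of `guessNFA`. `skip j`: `j` letters modulo `2 t` were skipped. `pair i`: there are
`i` pairs left to check. `memo u i`: the second letter of the current pair has to be related to
`u`, and `i` pairs follow. `rest j`: all pairs were checked, and `j` letters modulo `2 t` were read
since. -/
inductive GuessState (t : ℕ) (U : Type*)
  | skip (j : ZMod (2 * t))
  | pair (i : Fin t)
  | memo (u : U) (i : Fin t)
  | rest (j : ZMod (2 * t))

open GuessState

/-- `GuessState` as a sum of finite types. -/
def GuessState.equivSum (t : ℕ) (U : Type*) : GuessState t U ≃
    (ZMod (2 * t) ⊕ Fin t) ⊕ ((U × Fin t) ⊕ ZMod (2 * t)) where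
  toFun
    | skip j => .inl (.inl j)
    | pair i => .inl (.inr i)
    | memo u i => .inr (.inl (u, i))
    | rest j => .inr (.inr j)
  invFun
    | .inl (.inl j) => skip j
    | .inl (.inr i) => pair i
    | .inr (.inl (u, i)) => memo u i
    | .inr (.inr j) => rest j
  left_inv q := by cases q <;> rfl
  right_inv q := by rcases q with (_ | _) | (_ | _) <;> rfl

/-- The automaton that skips blocks of length `2 t`, guesses a block, and checks its `t` pairs by
guessing a common element of each. -/
def guessNFA (t : ℕ) (mem : U → A → Prop) : NFA A (GuessState t U) where
  step
    | skip j, a => {q | q = skip (j + 1) ∨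
        (j = 0 ∧ ∃ (u : U) (i : Fin t), i.val + 1 = t ∧ mem u a ∧ q = memo u i)}
    | pair i, a => {q | (i.val = 0 ∧ q = rest 1) ∨
        ∃ (u : U) (i' : Fin t), i'.val + 1 = i.val ∧ mem u a ∧ q = memo u i'}
    | memo u i, a => {q | mem u a ∧ q = pair i}
    | rest j, _ => {q | q = rest (j + 1)}
  start := {skip 0}
  accept := {q | q = rest 0 ∨ ∃ i : Fin t, i.val = 0 ∧ q = pair i}

variable {t : ℕ} {mem : U → A → Prop}

theorem guessNFA_rest {w : List A} {j : ZMod (2 * t)} :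
    w ∈ (guessNFA t mem).acceptsFrom {rest j} ↔ j + (w.length : ZMod (2 * t)) = 0 := by
  induction w generalizing j with
  | nil => simp [NFA.nil_mem_acceptsFrom, guessNFA]
  | cons a w ih =>
    rw [NFA.cons_mem_acceptsFrom_singleton]
    have : ∀ q', q' ∈ (guessNFA t mem).step (rest j) a ↔ q' = rest (j + 1) := fun _ => Iff.rfl
    simp only [this, exists_eq_left, ih, List.length_cons, Nat.cast_add, Nat.cast_one]
    rw [add_assoc, add_comm (1 : ZMod (2 * t))]

/-- The behaviour of `pair i` is a hypothesis so that this can be used inside the induction of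
`guessNFA_pair`, where the state for `i + 1` leads to `memo u i`. -/
theorem guessNFA_memo {i : Fin t} (hpair : ∀ {w : List A},
      w ∈ (guessNFA t mem).acceptsFrom {pair i} ↔
        ∃ v x, w = v ++ x ∧ v ∈ commonPairs mem ^ i.val ∧ 2 * t ∣ x.length)
    {u : U} {w : List A} :
    w ∈ (guessNFA t mem).acceptsFrom {memo u i} ↔
      ∃ y v x, w = y :: (v ++ x) ∧ mem u y ∧ v ∈ commonPairs mem ^ i.val ∧ 2 * t ∣ x.length := by
  cases w with
  | nil => simp [NFA.nil_mem_acceptsFrom, guessNFA]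
  | cons a w =>
    rw [NFA.cons_mem_acceptsFrom_singleton]
    have : ∀ q', q' ∈ (guessNFA t mem).step (memo u i) a ↔ mem u a ∧ q' = pair i :=
      fun _ => Iff.rfl
    simp only [this]
    constructor
    · rintro ⟨_, ⟨ha, rfl⟩, h⟩
      obtain ⟨v, x, rfl, hv, hx⟩ := hpair.1 h
      exact ⟨a, v, x, rfl, ha, hv, hx⟩
    · rintro ⟨y, v, x, h, hy, hv, hx⟩
      obtain ⟨rfl, rfl⟩ := List.cons.inj h
      exact ⟨_, ⟨hy, rfl⟩, hpair.2 ⟨v, x, rfl, hv, hx⟩⟩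

theorem guessNFA_pair {w : List A} {i : Fin t} :
    w ∈ (guessNFA t mem).acceptsFrom {pair i} ↔
      ∃ v x, w = v ++ x ∧ v ∈ commonPairs mem ^ i.val ∧ 2 * t ∣ x.length := by
  obtain ⟨i, hi⟩ := i
  induction i generalizing w with
  | zero =>
    have hr : (∃ v x, w = v ++ x ∧ v ∈ commonPairs mem ^ 0 ∧ 2 * t ∣ x.length) ↔
        2 * t ∣ w.length := by
      simp [pow_zero, Language.mem_one]
    rw [hr]
    cases w with
    | nil => simp [NFA.nil_mem_acceptsFrom, guessNFA]
    | cons a w =>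
      rw [NFA.cons_mem_acceptsFrom_singleton]
      -- The state `pair 0` doubles as `rest 0`: it accepts, and any letter leads to `rest 1`.
      have : ∀ q', q' ∈ (guessNFA t mem).step (pair ⟨0, hi⟩) a ↔ q' = rest 1 := by
        intro q'
        constructor
        · rintro (h | ⟨_, _, h, _⟩)
          · exact h.2
          · simp at h
        · exact fun h => Or.inl ⟨rfl, h⟩
      simp only [this, exists_eq_left, guessNFA_rest, List.length_cons]
      rw [← ZMod.natCast_eq_zero_iff]
      push_cast
      rw [add_comm]
  | succ i ih =>
    have hrec := fun (u : U) (w : List A) => guessNFA_memo (mem := mem) (u := u) (w := w)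
      (i := ⟨i, Nat.lt_of_succ_lt hi⟩) (ih (Nat.lt_of_succ_lt hi))
    cases w with
    | nil =>
      simp only [NFA.nil_mem_acceptsFrom, List.nil_eq, List.append_eq_nil_iff]
      constructor
      · rintro ⟨_, rfl, h | ⟨i', hi', h⟩⟩
        · cases h
        · cases h
          simp at hi'
      · rintro ⟨v, x, ⟨rfl, rfl⟩, hv, -⟩
        have := length_of_mem_commonPairs_pow hv
        simp at this
    | cons a w =>
      rw [NFA.cons_mem_acceptsFrom_singleton]
      constructor
      · rintro ⟨_, (⟨h, -⟩ | ⟨u, i', hi', ha, rfl⟩), h2⟩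
        · simp at h
        · obtain ⟨i', hi2⟩ := i'
          obtain rfl : i' = i := by simpa using hi'
          obtain ⟨y, v, x, rfl, hy, hv, hx⟩ := (hrec u w).1 h2
          refine ⟨[a, y] ++ v, x, by simp, ?_, hx⟩
          simp only [pow_succ']
          exact Language.append_mem_mul ⟨a, y, u, rfl, ha, hy⟩ hv
      · rintro ⟨v, x, h, hv, hx⟩
        simp only [pow_succ', Language.mem_mul] at hv
        obtain ⟨_, ⟨a', y, u, rfl, ha, hy⟩, v, hv, rfl⟩ := hv
        simp only [List.cons_append, List.nil_append, List.cons.injEq] at h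
        obtain ⟨rfl, rfl⟩ := h
        exact ⟨_, Or.inr ⟨u, ⟨i, Nat.lt_of_succ_lt hi⟩, rfl, ha, rfl⟩,
          (hrec u _).2 ⟨y, v, x, rfl, hy, hv, hx⟩⟩

theorem guessNFA_skip (ht : 0 < t) {w : List A} {j : ZMod (2 * t)} :
    w ∈ (guessNFA t mem).acceptsFrom {skip j} ↔
      ∃ s v x, w = s ++ (v ++ x) ∧ j + (s.length : ZMod (2 * t)) = 0 ∧
        v ∈ commonPairs mem ^ t ∧ 2 * t ∣ x.length := by
  obtain ⟨n, rfl⟩ := Nat.exists_eq_succ_of_ne_zero ht.ne'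
  induction w generalizing j with
  | nil =>
    constructor
    · simp [NFA.nil_mem_acceptsFrom, guessNFA]
    · rintro ⟨s, v, x, h, -, hv, -⟩
      have h1 := length_of_mem_commonPairs_pow hv
      have h2 := congrArg List.length h
      simp only [List.length_append, List.length_nil] at h2
      omega
  | cons a w ih =>
    have hrec := fun (u : U) (w : List A) => guessNFA_memo (mem := mem) (u := u) (w := w)
      (i := ⟨n, Nat.lt_succ_self n⟩) guessNFA_pair
    rw [NFA.cons_mem_acceptsFrom_singleton]
    constructor
    · rintro ⟨_, (rfl | ⟨rfl, u, i, hi, ha, rfl⟩), h⟩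
      · obtain ⟨s, v, x, rfl, hs, hv, hx⟩ := ih.1 h
        refine ⟨a :: s, v, x, rfl, ?_, hv, hx⟩
        rw [← hs, List.length_cons]
        push_cast
        ring
      · obtain ⟨i, hi2⟩ := i
        obtain rfl : i = n := by simpa using hi
        obtain ⟨y, v, x, rfl, hy, hv, hx⟩ := (hrec u w).1 h
        refine ⟨[], [a, y] ++ v, x, by simp, by simp, ?_, hx⟩
        simp only [Nat.succ_eq_add_one, pow_succ']
        exact Language.append_mem_mul ⟨a, y, u, rfl, ha, hy⟩ hv
    · rintro ⟨s, v, x, h, hs, hv, hx⟩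
      cases s with
      | nil =>
        simp only [Nat.succ_eq_add_one, pow_succ', Language.mem_mul] at hv
        obtain ⟨_, ⟨a', y, u, rfl, ha, hy⟩, v, hv, rfl⟩ := hv
        simp only [List.cons_append, List.nil_append, List.cons.injEq] at h
        obtain ⟨rfl, rfl⟩ := h
        exact ⟨_, Or.inr ⟨by simpa using hs, u, ⟨n, Nat.lt_succ_self n⟩, rfl, ha, rfl⟩,
          (hrec u _).2 ⟨y, v, x, rfl, hy, hv, hx⟩⟩
      | cons b s =>
        simp only [List.cons_append, List.cons.injEq] at h
        obtain ⟨rfl, rfl⟩ := h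
        refine ⟨_, Or.inl rfl, ih.2 ⟨s, v, x, rfl, ?_, hv, hx⟩⟩
        rw [← hs, List.length_cons]
        push_cast
        ring

theorem guessNFA_accepts (ht : 0 < t) :
    (guessNFA t mem).accepts = existsOne (2 * t) (commonPairs mem ^ t) := by
  ext w
  rw [mem_existsOne_iff fun b hb => length_of_mem_commonPairs_pow hb,
    NFA.accepts_eq_acceptsFrom_start]
  change w ∈ (guessNFA t mem).acceptsFrom {skip 0} ↔ _
  simp only [guessNFA_skip ht, zero_add, ZMod.natCast_eq_zero_iff]

/-- A bound on the number of accepting computations of `guessNFA` on words of length `n`, by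
their first state. -/
def guessPotential (t R n : ℕ) : GuessState t U → ℕ
  | skip _ => n * R ^ t
  | pair i => R ^ i.val
  | memo _ i => R ^ i.val
  | rest _ => 1

theorem guessNFA_ambigWord_le [Fintype (GuessState t U)] [Fintype U] (x : List A) :
    (guessNFA t mem).ambigWord x ≤ x.length * Fintype.card U ^ t := by
  classical
  refine NFA.ambigWord_le_of_potential (guessNFA t mem)
    (guessPotential t (Fintype.card U)) (skip 0) rfl ?_ ?_ x
  · rintro _ (rfl | ⟨i, hi, rfl⟩)
    · exact le_rfl
    · simp [guessPotential, hi]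
  -- There are at most `|U|` elements to guess, and each leaves potential `|U| ^ i`.
  · have hrecall : ∀ n (i : Fin t), ∑ q' ∈ Finset.univ.image (fun u : U => memo u i),
        guessPotential t (Fintype.card U) n q' ≤ Fintype.card U ^ (i.val + 1) := by
      intro n i
      refine (Finset.sum_le_card_nsmul _ _ (Fintype.card U ^ i.val) ?_).trans ?_
      · simp [guessPotential]
      · rw [smul_eq_mul, pow_succ']
        exact Nat.mul_le_mul_right _ Finset.card_image_le
    rintro n (j | i | ⟨u, i⟩ | j) a
    · rcases Nat.eq_zero_or_pos t with ht | ht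
      · refine (NFA.sum_stepMatrix_mul_le _ {skip (j + 1)} ?_ _).trans ?_
        · rintro q (rfl | ⟨-, -, i, -⟩)
          · simp
          · exact absurd i.2 (by omega)
        · simp only [Finset.sum_singleton, guessPotential]
          exact Nat.mul_le_mul_right _ (Nat.le_succ n)
      -- Skipping on keeps the potential `n * |U| ^ t`; starting the check adds at most `|U| ^ t`.
      · refine (NFA.sum_stepMatrix_mul_le _ ({skip (j + 1)} ∪
          Finset.univ.image (fun u : U => memo u ⟨t - 1, by omega⟩)) ?_ _).trans ?_
        · rintro q (rfl | ⟨-, u, i, hi, -, rfl⟩)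
          · simp
          · have hi' : i = ⟨t - 1, by omega⟩ := Fin.ext (by simp; omega)
            rw [hi']
            simp
        · refine (le_of_le_of_eq (Nat.le_add_right _ _) Finset.sum_union_inter).trans ?_
          refine (Nat.add_le_add_left (hrecall n _) _).trans ?_
          simp only [Finset.sum_singleton, guessPotential]
          rw [Nat.sub_add_cancel ht, add_mul, one_mul]
    · obtain ⟨i, hi⟩ := i
      cases i with
      | zero =>
        refine (NFA.sum_stepMatrix_mul_le _ {rest 1} ?_ _).trans ?_
        · rintro q (⟨-, rfl⟩ | ⟨_, _, h, -⟩)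
          · simp
          · simp at h
        · simp [guessPotential]
      | succ i =>
        refine (NFA.sum_stepMatrix_mul_le _
          (Finset.univ.image (fun u : U => memo u ⟨i, by omega⟩)) ?_ _).trans (hrecall n _)
        rintro q (⟨h, -⟩ | ⟨u, i', hi', -, rfl⟩)
        · simp at h
        · have hi2 : i' = ⟨i, by omega⟩ := Fin.ext (by simpa using hi')
          rw [hi2]
          simp
    · refine (NFA.sum_stepMatrix_mul_le _ {pair i} ?_ _).trans ?_
      · rintro q ⟨-, rfl⟩
        simp
      · simp [guessPotential]
    · refine (NFA.sum_stepMatrix_mul_le _ {rest (j + 1)} ?_ _).trans ?_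
      · rintro q rfl
        simp
      · simp [guessPotential]

end Guess

theorem nonDisj_eq_commonPairs (r : ℕ) :
    nonDisj r = commonPairs fun (u : Fin (r ^ 32)) (x : SubsetLetter r) => u ∈ x.1 := by
  ext w
  constructor
  · rintro ⟨x, y, rfl, h⟩
    obtain ⟨u, hu⟩ := Finset.nonempty_iff_ne_empty.2 h
    exact ⟨x, y, u, rfl, (Finset.mem_inter.1 hu).1, (Finset.mem_inter.1 hu).2⟩
  · rintro ⟨x, y, u, rfl, hx, hy⟩
    exact ⟨x, y, rfl, Finset.nonempty_iff_ne_empty.1 ⟨u, Finset.mem_inter.2 ⟨hx, hy⟩⟩⟩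

theorem exists_linear_ambiguity_nfa (r t : ℕ) (ht : 0 < t) :
    ∃ s : ℕ, s = 5 * t + t * r ^ 32 ∧ ∃ N : NFA (SubsetLetter r) (Fin s),
      (∃ q₀ : Fin s, N.start = {q₀}) ∧ N.accepts = existsOne (2 * t) (nonDisj r ^ t) ∧
        N.HasLinearAmbiguity := by
  classical
  have : NeZero (2 * t) := ⟨by omega⟩
  let e := GuessState.equivSum t (Fin (r ^ 32))
  let : Fintype (GuessState t (Fin (r ^ 32))) := Fintype.ofEquiv _ e.symm
  have hcard : Fintype.card (GuessState t (Fin (r ^ 32))) = 5 * t + t * r ^ 32 := by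
    rw [Fintype.card_congr e]
    simp [ZMod.card]
    ring
  let N := guessNFA t fun (u : Fin (r ^ 32)) (x : SubsetLetter r) => u ∈ x.1
  let f := Fintype.equivFinOfCardEq hcard
  refine ⟨_, rfl, N.mapEquiv f, ⟨f (.skip 0), ?_⟩, ?_, ?_⟩
  · ext q
    simp [NFA.mapEquiv, N, guessNFA, Equiv.symm_apply_eq]
  · rw [NFA.accepts_mapEquiv, guessNFA_accepts ht, nonDisj_eq_commonPairs]
  · refine NFA.hasLinearAmbiguity_of_le _ (Fintype.card (Fin (r ^ 32)) ^ t) fun x => ?_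
    rw [NFA.ambigWord_mapEquiv]
    exact guessNFA_ambigWord_le x

/-! ### Matrices of natural numbers and permutations. -/

theorem Matrix.mul_apply_pos_iff {σ : Type*} [Fintype σ] {A B : Matrix σ σ ℕ} {a b : σ} :
    0 < (A * B) a b ↔ ∃ c, 0 < A a c ∧ 0 < B c b := by
  rw [Matrix.mul_apply, pos_iff_ne_zero, ne_eq, Finset.sum_eq_zero_iff]
  simp only [Finset.mem_univ, true_imp_iff, not_forall, Nat.mul_eq_zero, not_or,
    ← ne_eq, ← pos_iff_ne_zero]

theorem Matrix.apply_mul_apply_le_mul_apply {σ : Type*} [Fintype σ] (A B : Matrix σ σ ℕ)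
    (a b c : σ) : A a c * B c b ≤ (A * B) a b := by
  rw [Matrix.mul_apply]
  exact Finset.single_le_sum (f := fun c => A a c * B c b) (fun _ _ => Nat.zero_le _)
    (Finset.mem_univ c)

/-- A matrix of natural numbers with a power equal to `1` is a permutation matrix. -/
theorem Matrix.exists_perm_of_pow_eq_one {P : Type*} [Fintype P] [DecidableEq P]
    {A : Matrix P P ℕ} {K : ℕ} (h : A ^ (K + 1) = 1) :
    ∃ g : Equiv.Perm P, ∀ p q, A p q = if g p = q then 1 else 0 := by
  have h1 : A * A ^ K = 1 := by rw [← pow_succ', h]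
  have h2 : A ^ K * A = 1 := by rw [← pow_succ, h]
  generalize A ^ K = D at h1 h2
  have aux : ∀ {A D : Matrix P P ℕ}, A * D = 1 → D * A = 1 →
      ∀ p, ∃ q, 0 < A p q ∧ 0 < D q p := by
    intro A D h1 h2 p
    have : 0 < (A * D) p p := by rw [h1]; simp
    exact Matrix.mul_apply_pos_iff.1 this
  -- Nonnegative entries cannot cancel. If `A p q` and `D q x` are positive then `x = p`, and a
  -- second positive entry in row `p` of `A` would produce an off-diagonal entry of `D * A`.
  have uniq : ∀ {A D : Matrix P P ℕ}, A * D = 1 → D * A = 1 →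
      ∀ {p q q'}, 0 < A p q → 0 < A p q' → q = q' := by
    intro A D h1 h2 p q q' hq hq'
    by_contra hne
    obtain ⟨x, hx, -⟩ := aux h2 h1 q
    have hxp : x = p := by
      by_contra hxp
      have : 0 < (A * D) p x := Matrix.mul_apply_pos_iff.2 ⟨q, hq, hx⟩
      rw [h1, Matrix.one_apply_ne (Ne.symm hxp)] at this
      exact lt_irrefl _ this
    subst hxp
    have : 0 < (D * A) q q' := Matrix.mul_apply_pos_iff.2 ⟨x, hx, hq'⟩
    rw [h2, Matrix.one_apply_ne hne] at this
    exact lt_irrefl _ this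
  choose f hf hfD using aux h1 h2
  choose e he heA using aux h2 h1
  have hAf : ∀ p q, A p q = if f p = q then 1 else 0 := by
    intro p q
    split_ifs with hpq
    · subst hpq
      have h3 := Matrix.apply_mul_apply_le_mul_apply A D p p (f p)
      rw [h1, Matrix.one_apply_eq] at h3
      have h4 := hf p
      have h5 := hfD p
      nlinarith
    · by_contra hne
      exact hpq (uniq h1 h2 (hf p) (Nat.pos_of_ne_zero hne))
  refine ⟨⟨f, e, fun p => ?_, fun q => ?_⟩, hAf⟩
  · exact uniq h2 h1 (he (f p)) (hfD p)
  · exact uniq h1 h2 (hf (e q)) (heA q)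

/-! ### Representations of sublinear growth and idempotent supports. -/

/-- A representation of a monoid of words by matrices of natural numbers whose entries, at the
indices in `useful`, grow less than linearly with the length of the words. -/
structure SlowRep (W σ : Type*) [Monoid W] [Fintype σ] [DecidableEq σ] where
  /-- The representation. -/
  M : W →* Matrix σ σ ℕ
  /-- The length of a word. -/
  len : W → ℕ
  /-- The useful indices. -/
  useful : Set σ
  len_mul : ∀ u v, len (u * v) = len u + len v
  convex : ∀ {a b c u v}, a ∈ useful → b ∈ useful → 0 < M u a c → 0 < M v c b → c ∈ useful
  slow : ∀ c : ℝ, 0 < c → ∀ C : ℕ, ∃ m : ℕ, ∀ u, len u ≤ C * (m + 1) →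
    ∀ p ∈ useful, ∀ q ∈ useful, (M u p q : ℝ) < c * m

namespace SlowRep

variable {W σ : Type*} [Monoid W] [Fintype σ] [DecidableEq σ] (S : SlowRep W σ)

theorem len_one : S.len 1 = 0 := by
  have := S.len_mul 1 1
  rw [mul_one] at this
  omega

theorem len_pow (v : W) (n : ℕ) : S.len (v ^ n) = n * S.len v := by
  induction n with
  | zero => simp [S.len_one]
  | succ n ih => rw [pow_succ, S.len_mul, ih]; ring

theorem pos_mul_iff {u v : W} {a b : σ} :
    0 < S.M (u * v) a b ↔ ∃ c, 0 < S.M u a c ∧ 0 < S.M v c b := by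
  rw [map_mul, Matrix.mul_apply_pos_iff]

theorem le_mul (u v : W) (a b c : σ) : S.M u a c * S.M v c b ≤ S.M (u * v) a b := by
  rw [map_mul]
  exact Matrix.apply_mul_apply_le_mul_apply _ _ _ _ _

theorem pos_mul {u v : W} {a b c : σ} (h : 0 < S.M u a c) (h' : 0 < S.M v c b) :
    0 < S.M (u * v) a b :=
  S.pos_mul_iff.2 ⟨c, h, h'⟩

theorem pos_pow {v : W} {p : σ} (h : 0 < S.M v p p) (n : ℕ) : 0 < S.M (v ^ n) p p := by
  induction n with
  | zero => simp
  | succ n ih => rw [pow_succ]; exact S.pos_mul ih h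

theorem false_of_linear_growth {p q : σ} (hp : p ∈ S.useful) (hq : q ∈ S.useful) (v : W)
    (h : ∀ m : ℕ, m ≤ S.M (v ^ m) p q) : False := by
  obtain ⟨m, hm⟩ := S.slow 1 one_pos (S.len v)
  have := hm (v ^ m) (by rw [S.len_pow, mul_comm]; exact Nat.mul_le_mul_left _ (Nat.le_succ m))
    p hp q hq
  rw [one_mul, Nat.cast_lt] at this
  exact absurd (h m) (not_le.2 this)

/-- Otherwise there are at least `m` runs from `p` to `q` on `v ^ m`, one for each moment of leaving
`p`. -/
theorem eq_of_two_loops {p q : σ} (hp : p ∈ S.useful) (hq : q ∈ S.useful) {v : W}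
    (hpp : 0 < S.M v p p) (hpq : 0 < S.M v p q) (hqq : 0 < S.M v q q) : p = q := by
  by_contra hne
  refine S.false_of_linear_growth hp hq v fun m => ?_
  induction m with
  | zero => exact Nat.zero_le _
  | succ m ih =>
    rw [pow_succ, map_mul, Matrix.mul_apply]
    refine le_trans ?_ (Finset.sum_le_sum_of_subset (Finset.subset_univ {p, q}))
    rw [Finset.sum_pair hne]
    have := Nat.mul_pos (S.pos_pow hpp m) hpq
    have := Nat.le_mul_of_pos_right (S.M (v ^ m) p q) hqq
    omega

/-- Two runs from `p` back to `p` would give `2 ^ m` runs on `v ^ m`. -/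
theorem apply_le_one {p : σ} (hp : p ∈ S.useful) {v : W} : S.M v p p ≤ 1 := by
  by_contra! h
  refine S.false_of_linear_growth hp hp v fun m => ?_
  have : 2 ^ m ≤ S.M (v ^ m) p p := by
    induction m with
    | zero => simp
    | succ m ih =>
      rw [pow_succ, pow_succ]
      exact (Nat.mul_le_mul ih h).trans (S.le_mul _ _ _ _ _)
  exact (Nat.lt_two_pow_self).le.trans this

/-- The support of the matrix of `z` is an idempotent relation. -/
def IsIdem (z : W) : Prop := ∀ a b, 0 < S.M (z * z) a b ↔ 0 < S.M z a b

/-- There are finitely many supports, and the support of a product depends only on those of the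
factors, so the supports of the powers of `v` are eventually periodic. -/
theorem exists_isIdem_pow (v : W) : ∃ K, S.IsIdem (v ^ (K + 2)) := by
  let supp : W → Set (σ × σ) := fun v => {x | 0 < S.M v x.1 x.2}
  have hsupp : ∀ {x y : W} (w : W), supp x = supp y → supp (x * w) = supp (y * w) := by
    intro x y w h
    ext ⟨a, b⟩
    have h' : ∀ c, 0 < S.M x a c ↔ 0 < S.M y a c := fun c => Set.ext_iff.1 h (a, c)
    simp only [supp, Set.mem_ofPred_eq, S.pos_mul_iff, h']
  obtain ⟨i, j, hij, h⟩ := Finite.exists_ne_map_eq_of_infinite fun n : ℕ => supp (v ^ (n + 1))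
  wlog hlt : i < j generalizing i j
  · exact this j i hij.symm h.symm (lt_of_le_of_ne (not_lt.1 hlt) hij.symm)
  obtain ⟨d, rfl⟩ := Nat.exists_eq_add_of_lt hlt
  have hper : ∀ n, supp (v ^ (i + 1 + n + (d + 1))) = supp (v ^ (i + 1 + n)) := by
    intro n
    have := hsupp (v ^ n) h
    simp only [← pow_add] at this
    rw [this]
    congr 2
    ring
  have hper' : ∀ k n, supp (v ^ (i + 1 + n + k * (d + 1))) = supp (v ^ (i + 1 + n)) := by
    intro k
    induction k with
    | zero => simp
    | succ k ih =>
      intro n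
      rw [← ih n]
      refine Eq.trans ?_ ((hper (n + k * (d + 1))).trans ?_) <;> congr 2 <;> ring
  -- The exponent `2 * (i + 1) * (d + 1)` is a multiple of the period `d + 1`, lies beyond the
  -- preperiod `i + 1`, and is at least `2`.
  refine ⟨2 * (i + 1) * (d + 1) - 2, fun a b => ?_⟩
  have h2 : 2 ≤ 2 * (i + 1) * (d + 1) := by nlinarith [Nat.zero_le (i * d)]
  rw [Nat.sub_add_cancel h2, ← pow_add]
  obtain ⟨n, hn⟩ : ∃ n, 2 * (i + 1) * (d + 1) = i + 1 + n :=
    Nat.exists_eq_add_of_le (by nlinarith [Nat.zero_le (i * d)])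
  have := hper' (2 * (i + 1)) n
  rw [← hn] at this
  exact Set.ext_iff.1 this (a, b)

variable {S}

/-- Idempotence allows every edge to be subdivided. Without a loop the edges between the
intermediate states would form a finite strict order, but subdividing the edge from `a` to a minimal
state gives a smaller one. -/
theorem IsIdem.exists_loop {z : W} (hz : S.IsIdem z) {a b : σ} (h : 0 < S.M z a b) :
    ∃ r, 0 < S.M z a r ∧ 0 < S.M z r r ∧ 0 < S.M z r b := by
  by_contra! hno
  let T : Type _ := {r : σ // 0 < S.M z a r ∧ 0 < S.M z r b}
  let rel : T → T → Prop := fun x y => 0 < S.M z x.1 y.1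
  have : Std.Irrefl rel := ⟨fun x hx => absurd x.2.2 (not_lt.2 (hno x.1 x.2.1 hx))⟩
  have : IsTrans T rel := ⟨fun x y w h1 h2 => (hz _ _).1 (S.pos_mul h1 h2)⟩
  have hwf : WellFounded rel := Finite.wellFounded_of_trans_of_irrefl rel
  obtain ⟨c, hc1, hc2⟩ := S.pos_mul_iff.1 ((hz a b).2 h)
  obtain ⟨x, -, hx⟩ := hwf.has_min Set.univ ⟨(⟨c, hc1, hc2⟩ : T), trivial⟩
  obtain ⟨d, hd1, hd2⟩ := S.pos_mul_iff.1 ((hz a x.1).2 x.2.1)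
  exact hx ⟨d, hd1, (hz _ _).1 (S.pos_mul hd2 x.2.2)⟩ trivial hd2

variable (S) in
open Classical in
/-- The useful indices with a positive diagonal entry. -/
noncomputable def loops (z : W) : Finset σ :=
  Finset.univ.filter fun p => p ∈ S.useful ∧ 0 < S.M z p p

theorem mem_loops {z : W} {p : σ} : p ∈ S.loops z ↔ p ∈ S.useful ∧ 0 < S.M z p p := by
  simp [loops]

/-- The state `x` sits between two factors `z`. Contracting these to a single `z` and subdividing
its edge at a loop replaces `x` by a loop. -/
theorem IsIdem.exists_loop_between {z : W} (hz : S.IsIdem z) {u v : W} {a b x : σ}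
    (ha : a ∈ S.useful) (hb : b ∈ S.useful) (h : 0 < S.M (u * z) a x)
    (h' : 0 < S.M (z * v) x b) :
    ∃ r ∈ S.loops z, 0 < S.M (u * z) a r ∧ 0 < S.M (z * v) r b := by
  obtain ⟨y, hy, hyx⟩ := S.pos_mul_iff.1 h
  obtain ⟨y', hxy', hy'⟩ := S.pos_mul_iff.1 h'
  obtain ⟨r, h1, h2, h3⟩ := hz.exists_loop ((hz y y').1 (S.pos_mul hyx hxy'))
  have h4 := S.pos_mul hy h1
  have h5 := S.pos_mul h3 hy'
  exact ⟨r, mem_loops.2 ⟨S.convex ha hb h4 h5, h2⟩, h4, h5⟩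

/-- A run on `v` from `p` to itself begins with a run on `z`, which can be led through a loop `r` of
`z`. Then `v` has runs from `p` to `r` and back, so `r` is also a loop of `v`, and `eq_of_two_loops`
forces `r = p`. -/
theorem IsIdem.loops_subset {z v v₁ v₂ : W} (hz : S.IsIdem z) (hv : S.IsIdem v)
    (h₁ : v = z * v₁) (h₂ : v = v₂ * z) : S.loops v ⊆ S.loops z := by
  intro p hp
  obtain ⟨hpU, hpp⟩ := mem_loops.1 hp
  obtain ⟨x, hx, hx'⟩ := S.pos_mul_iff.1 (h₁ ▸ hpp)
  obtain ⟨y, hy, hy'⟩ := S.pos_mul_iff.1 (h₂ ▸ hpp)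
  obtain ⟨r, h3, h4, h5⟩ := hz.exists_loop hx
  have hrp : 0 < S.M v r p := h₁ ▸ S.pos_mul h5 hx'
  have hpr : 0 < S.M v p r := h₂ ▸ S.pos_mul hy ((hz _ _).1 (S.pos_mul hy' h3))
  have hrr : 0 < S.M v r r := (hv _ _).1 (S.pos_mul hrp hpr)
  have hrU : r ∈ S.useful := S.convex hpU hpU hpr hrp
  obtain rfl := S.eq_of_two_loops hpU hrU hpp hpr hrr
  exact mem_loops.2 ⟨hpU, h4⟩

variable (S) in
theorem exists_isIdem_min (Z : Submonoid W) : ∃ z ∈ Z, S.IsIdem z ∧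
    ∀ v ∈ Z, S.IsIdem v → (S.loops z).card ≤ (S.loops v).card := by
  have hex : ∃ n, ∃ z ∈ Z, S.IsIdem z ∧ (S.loops z).card = n :=
    ⟨_, 1, Z.one_mem, fun a b => by rw [one_mul], rfl⟩
  classical
  obtain ⟨z, hz, hi, hc⟩ := Nat.find_spec hex
  exact ⟨z, hz, hi, fun v hv hiv => hc ▸ Nat.find_min' hex ⟨v, hv, hiv, rfl⟩⟩

variable (S) in
/-- The matrix of `z * u * z`, restricted to the loops of `z`. -/
noncomputable def loopMatrix (z u : W) : Matrix (S.loops z) (S.loops z) ℕ :=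
  (S.M (z * u * z)).submatrix Subtype.val Subtype.val

theorem loopMatrix_apply (z u : W) (p q : S.loops z) :
    S.loopMatrix z u p q = S.M (z * u * z) p q := rfl

theorem sum_loops_le (z u v : W) (p q : S.loops z) :
    ∑ x : S.loops z, S.M u p x * S.M v x q ≤ S.M (u * v) p q := by
  rw [map_mul, Matrix.mul_apply, Finset.sum_coe_sort (S.loops z) fun x => S.M u p x * S.M v x q]
  exact Finset.sum_le_sum_of_subset (Finset.subset_univ _)

theorem loopMatrix_mul_le (z u v : W) (p q : S.loops z) :
    (S.loopMatrix z u * S.loopMatrix z v) p q ≤ S.loopMatrix z (u * z * z * v) p q := by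
  rw [Matrix.mul_apply, loopMatrix_apply]
  refine (sum_loops_le z (z * u * z) (z * v * z) p q).trans (le_of_eq ?_)
  simp only [mul_assoc]

theorem loopMatrix_pow_le (z u : W) (n : ℕ) (p q : S.loops z) :
    (S.loopMatrix z u ^ n) p q ≤ S.M ((z * u * z) ^ n) p q := by
  induction n generalizing q with
  | zero => simp only [pow_zero, map_one, Matrix.one_apply, Subtype.ext_iff, le_refl]
  | succ n ih =>
    rw [pow_succ, pow_succ, Matrix.mul_apply]
    exact (Finset.sum_le_sum fun x _ => Nat.mul_le_mul_right _ (ih x)).trans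
      (sum_loops_le z _ _ p q)

/-- Adjacent factors `z * u * z` meet in `z * z`, so each intermediate state can be exchanged for a
loop of `z`. -/
theorem IsIdem.loopMatrix_pow_pos {z : W} (hz : S.IsIdem z) (u : W) (n : ℕ) (p q : S.loops z)
    (h : 0 < S.M ((z * u * z) ^ (n + 1)) p q) : 0 < (S.loopMatrix z u ^ (n + 1)) p q := by
  induction n generalizing q with
  | zero => simpa only [zero_add, pow_one, loopMatrix_apply] using h
  | succ n ih =>
    rw [pow_succ] at h
    obtain ⟨x, hx, hx'⟩ := S.pos_mul_iff.1 h
    rw [pow_succ, ← mul_assoc, ← mul_assoc] at hx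
    rw [mul_assoc] at hx'
    obtain ⟨r, hr, h1, h2⟩ := hz.exists_loop_between (mem_loops.1 p.2).1 (mem_loops.1 q.2).1 hx hx'
    rw [mul_assoc, mul_assoc, ← mul_assoc z u z, ← pow_succ] at h1
    rw [← mul_assoc] at h2
    rw [pow_succ, Matrix.mul_apply_pos_iff]
    exact ⟨⟨r, hr⟩, ih ⟨r, hr⟩ h1, h2⟩

/-- By minimality an idempotent power of `z * u * z` has the same loops as `z`. Its diagonal entries
there are at most 1, and it has no run joining two distinct loops. -/
theorem exists_loopMatrix_pow_eq_one {Z : Submonoid W} {z u : W} (hzZ : z ∈ Z) (hu : u ∈ Z)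
    (hz : S.IsIdem z) (hmin : ∀ v ∈ Z, S.IsIdem v → (S.loops z).card ≤ (S.loops v).card) :
    ∃ K, S.loopMatrix z u ^ (K + 1) = 1 := by
  obtain ⟨K, hK⟩ := S.exists_isIdem_pow (z * u * z)
  have hsub : S.loops ((z * u * z) ^ (K + 2)) ⊆ S.loops z := by
    refine hz.loops_subset hK (v₁ := u * z * (z * u * z) ^ (K + 1))
      (v₂ := (z * u * z) ^ (K + 1) * (z * u)) ?_ ?_
    · rw [pow_succ' _ (K + 1)]
      simp only [mul_assoc]
    · rw [pow_succ _ (K + 1)]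
      simp only [mul_assoc]
  have heq := Finset.eq_of_subset_of_card_le hsub
    (hmin _ (Z.pow_mem (Z.mul_mem (Z.mul_mem hzZ hu) hzZ) _) hK)
  refine ⟨K + 1, ?_⟩
  have hloop : ∀ p : S.loops z, 0 < S.M ((z * u * z) ^ (K + 2)) p p := fun p =>
    (mem_loops.1 (heq.symm.subset p.2)).2
  ext p q
  have hpU := (mem_loops.1 p.2).1
  by_cases hpq : p = q
  · subst hpq
    rw [Matrix.one_apply_eq]
    refine le_antisymm ((loopMatrix_pow_le z u _ p p).trans (S.apply_le_one hpU)) ?_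
    exact hz.loopMatrix_pow_pos u (K + 1) p p (hloop p)
  · rw [Matrix.one_apply_ne hpq]
    by_contra hne
    refine hpq (Subtype.ext (S.eq_of_two_loops hpU (mem_loops.1 q.2).1 (hloop p) ?_ (hloop q)))
    exact (Nat.pos_of_ne_zero hne).trans_le (loopMatrix_pow_le z u _ p q)

end SlowRep

/-! ### The permutation group on the loops, and growth by averaging over it. -/

namespace SlowRep

variable {W σ : Type*} [Monoid W] [Fintype σ] [DecidableEq σ] {S : SlowRep W σ}

/-- The permutations of the loops of `z` that are given by elements of `Z`. -/
def loopGroup (S : SlowRep W σ) {Z : Submonoid W} {z : W} (hzZ : z ∈ Z) (hz : S.IsIdem z)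
    (hmin : ∀ v ∈ Z, S.IsIdem v → (S.loops z).card ≤ (S.loops v).card) :
    Subgroup (Equiv.Perm (S.loops z)) :=
  let T : Submonoid (Equiv.Perm (S.loops z)) :=
    { carrier := {g | ∃ u ∈ Z, ∀ p q, S.loopMatrix z u p q = if g p = q then 1 else 0}
      one_mem' := by
        refine ⟨1, Z.one_mem, ?_⟩
        obtain ⟨K, hK⟩ := exists_loopMatrix_pow_eq_one hzZ Z.one_mem hz hmin
        obtain ⟨g, hg⟩ := Matrix.exists_perm_of_pow_eq_one hK
        have hpp : ∀ p, g p = p := by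
          intro p
          by_contra hne
          have h1 := hg p p
          rw [if_neg hne, loopMatrix_apply, mul_one] at h1
          exact absurd ((hz p p).2 (mem_loops.1 p.2).2) (by rw [h1]; exact lt_irrefl 0)
        intro p q
        rw [hg, hpp]
        rfl
      mul_mem' := by
        rintro a b ⟨u, hu, ha⟩ ⟨v, hv, hb⟩
        -- Between two factors `z` this word is the product of `z * v * z` and `z * u * z`; the word
        -- of `b` comes first because `a * b` applies `b` first.
        have hmem : v * z * z * u ∈ Z := Z.mul_mem (Z.mul_mem (Z.mul_mem hv hzZ) hzZ) hu
        refine ⟨v * z * z * u, hmem, ?_⟩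
        obtain ⟨K, hK⟩ := exists_loopMatrix_pow_eq_one hzZ hmem hz hmin
        obtain ⟨g, hg⟩ := Matrix.exists_perm_of_pow_eq_one hK
        have hgab : ∀ p, g p = a (b p) := by
          intro p
          by_contra hne
          have h1 := loopMatrix_mul_le z v u p (a (b p))
          rw [hg, if_neg hne] at h1
          have h2 := Matrix.apply_mul_apply_le_mul_apply (S.loopMatrix z v) (S.loopMatrix z u)
            p (a (b p)) (b p)
          rw [hb, ha, if_pos rfl, if_pos rfl] at h2
          omega
        intro p q
        rw [hg, hgab]
        rfl }
  { T with
    inv_mem' := by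
      intro g hg
      have h1 : g⁻¹ = g ^ (orderOf g - 1) := by
        rw [inv_eq_iff_mul_eq_one, ← pow_succ', Nat.sub_add_cancel (orderOf_pos g),
          pow_orderOf_eq_one]
      change g⁻¹ ∈ T
      rw [h1]
      exact T.pow_mem hg _ }

section

variable {Z : Submonoid W} {z : W} {hzZ : z ∈ Z} {hz : S.IsIdem z}
  {hmin : ∀ v ∈ Z, S.IsIdem v → (S.loops z).card ≤ (S.loops v).card}

theorem mem_loopGroup {g : Equiv.Perm (S.loops z)} : g ∈ S.loopGroup hzZ hz hmin ↔
    ∃ u ∈ Z, ∀ p q, S.loopMatrix z u p q = if g p = q then 1 else 0 := Iff.rfl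

theorem exists_mem_loopGroup {u : W} (hu : u ∈ Z) : ∃ g ∈ S.loopGroup hzZ hz hmin,
    ∀ p q, S.loopMatrix z u p q = if g p = q then 1 else 0 := by
  obtain ⟨K, hK⟩ := exists_loopMatrix_pow_eq_one hzZ hu hz hmin
  obtain ⟨g, hg⟩ := Matrix.exists_perm_of_pow_eq_one hK
  exact ⟨g, ⟨u, hu, hg⟩, hg⟩

end

/-- The average of `f` over the orbit of `p` under a finite group of permutations. -/
noncomputable def orbitAvg {P : Type*} [Fintype P] [DecidableEq P] (H : Subgroup (Equiv.Perm P))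
    (f : P → ℝ) (p : P) : ℝ :=
  (∑ᶠ g : H, f (g.1 p)) / Nat.card H

section OrbitAvg

variable {P : Type*} [Fintype P] [DecidableEq P] (H : Subgroup (Equiv.Perm P))

theorem orbitAvg_eq [Fintype H] (f : P → ℝ) (p : P) :
    orbitAvg H f p = (∑ g : H, f (g.1 p)) / Fintype.card H := by
  rw [orbitAvg, finsum_eq_sum_of_fintype, Nat.card_eq_fintype_card]

theorem orbitAvg_apply (f : P → ℝ) (g : H) (p : P) :
    orbitAvg H f (g.1 p) = orbitAvg H f p := by
  classical
  have := Fintype.ofFinite H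
  rw [orbitAvg_eq, orbitAvg_eq]
  congr 1
  exact Equiv.sum_comp (Equiv.mulRight g) fun g' : H => f (g'.1 p)

theorem orbitAvg_nonneg {f : P → ℝ} (hf : ∀ p, 0 ≤ f p) (p : P) : 0 ≤ orbitAvg H f p := by
  have := Fintype.ofFinite H
  rw [orbitAvg_eq]
  exact div_nonneg (Finset.sum_nonneg fun _ _ => hf _) (Nat.cast_nonneg _)

theorem orbitAvg_pos {f : P → ℝ} (hf : ∀ p, 0 ≤ f p) {p : P} (hp : 0 < f p) :
    0 < orbitAvg H f p := by
  have := Fintype.ofFinite H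
  rw [orbitAvg_eq]
  refine div_pos ?_ (Nat.cast_pos.2 Fintype.card_pos)
  exact Finset.sum_pos' (fun _ _ => hf _) ⟨1, Finset.mem_univ _, hp⟩

theorem orbitAvg_add (f f' : P → ℝ) (p : P) :
    orbitAvg H (fun p => f p + f' p) p = orbitAvg H f p + orbitAvg H f' p := by
  have := Fintype.ofFinite H
  rw [orbitAvg_eq, orbitAvg_eq, orbitAvg_eq, Finset.sum_add_distrib, add_div]

theorem orbitAvg_mul (f : P → ℝ) (c : ℝ) (p : P) :
    orbitAvg H (fun p => f p * c) p = orbitAvg H f p * c := by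
  have := Fintype.ofFinite H
  rw [orbitAvg_eq, orbitAvg_eq, ← Finset.sum_mul]
  ring

theorem orbitAvg_congr {f f' : P → ℝ} {p : P} (h : ∀ g ∈ H, f (g p) = f' (g p)) :
    orbitAvg H f p = orbitAvg H f' p := by
  have := Fintype.ofFinite H
  rw [orbitAvg_eq, orbitAvg_eq]
  congr 1
  exact Finset.sum_congr rfl fun g _ => h g.1 g.2

theorem sum_orbitAvg (f : P → ℝ) : ∑ p, orbitAvg H f p = ∑ p, f p := by
  have := Fintype.ofFinite H
  simp only [orbitAvg_eq]
  rw [← Finset.sum_div, Finset.sum_comm, Finset.sum_congr rfl fun g _ => Equiv.sum_comp g.1 f,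
    Finset.sum_const, Finset.card_univ, nsmul_eq_mul, mul_div_cancel_left₀]
  exact Nat.cast_ne_zero.2 Fintype.card_ne_zero

/-- Derandomization: some group element does at least as well as the average, so an average over `H`
can be replaced by an actual word. -/
theorem exists_le_of_orbitAvg (v f : P → ℝ) :
    ∃ g ∈ H, ∑ p, v p * orbitAvg H f p ≤ ∑ p, v p * f (g p) := by
  have := Fintype.ofFinite H
  by_contra! h
  have h1 : ∑ g : H, ∑ p, v p * f (g.1 p) <
      ∑ _g : H, ∑ p, v p * orbitAvg H f p :=
    Finset.sum_lt_sum_of_nonempty ⟨1, Finset.mem_univ _⟩ fun g _ => h g.1 g.2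
  refine absurd h1 (not_lt.2 (le_of_eq ?_))
  rw [Finset.sum_const, Finset.card_univ, nsmul_eq_mul, Finset.sum_comm, Finset.mul_sum]
  refine Finset.sum_congr rfl fun p _ => ?_
  rw [orbitAvg_eq, ← Finset.mul_sum]
  have : (Fintype.card H : ℝ) ≠ 0 := Nat.cast_ne_zero.2 Fintype.card_ne_zero
  field_simp

end OrbitAvg

section

variable {Z : Submonoid W} {z : W} {hzZ : z ∈ Z} {hz : S.IsIdem z}
  {hmin : ∀ v ∈ Z, S.IsIdem v → (S.loops z).card ≤ (S.loops v).card}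

/-- Growth under "apply `w`, then average over `H`" is realised by words: in each round one group
element, selected for the current row vector `v`, replaces the average. The claim covers all
nonnegative `v` because the induction passes from `v` to its image. -/
theorem exists_word_of_growth (w : W) (h : ℕ → S.loops z → ℝ) (h0 : ∀ p, 0 ≤ h 0 p)
    (hstep : ∀ j p, h (j + 1) p ≤ orbitAvg (S.loopGroup hzZ hz hmin)
      (fun p => ∑ q, (S.loopMatrix z w p q : ℝ) * h j q) p) :
    ∃ C : ℕ, ∀ m, ∀ v : S.loops z → ℝ, (∀ p, 0 ≤ v p) → ∃ u, S.len u ≤ C * m ∧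
      ∑ p, v p * h m p ≤ ∑ p, ∑ q, v p * (S.M u p.1 q.1 : ℝ) * h 0 q := by
  classical
  set H := S.loopGroup hzZ hz hmin with hH
  have := Fintype.ofFinite H
  have hrep : ∀ g : H, ∃ u, ∀ p q, S.loopMatrix z u p q = if g.1 p = q then 1 else 0 :=
    fun g => by
      obtain ⟨u, -, hu⟩ := mem_loopGroup.1 g.2
      exact ⟨u, hu⟩
  choose rep hrep using hrep
  -- The sum over the group bounds the length added in a round, whichever element is selected.
  refine ⟨∑ g : H, S.len (z * rep g * z * (z * w * z)), fun m => ?_⟩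
  induction m with
  | zero =>
    refine fun v _ => ⟨1, by rw [S.len_one]; exact Nat.zero_le _, le_of_eq ?_⟩
    refine Finset.sum_congr rfl fun p _ => ?_
    simp only [map_one, Matrix.one_apply]
    rw [Finset.sum_eq_single p]
    · simp
    · intro q _ hq
      rw [if_neg fun h => hq (Subtype.ext h.symm)]
      simp
    · simp
  | succ m ih =>
    intro v hv
    obtain ⟨g, hg, hle⟩ := exists_le_of_orbitAvg H v
      fun p => ∑ q, (S.loopMatrix z w p q : ℝ) * h m q
    obtain ⟨u, hu, hle'⟩ := ih (fun q => ∑ p, v p * (S.loopMatrix z w (g p) q : ℝ))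
      fun q => Finset.sum_nonneg fun p _ => mul_nonneg (hv p) (Nat.cast_nonneg _)
    set x := z * rep ⟨g, hg⟩ * z * (z * w * z) with hx
    refine ⟨x * u, ?_, ?_⟩
    · rw [S.len_mul, mul_add, mul_one, add_comm]
      refine Nat.add_le_add hu ?_
      exact Finset.single_le_sum (f := fun g : H => S.len (z * rep g * z * (z * w * z)))
        (fun _ _ => Nat.zero_le _) (Finset.mem_univ (⟨g, hg⟩ : H))
    · have hxle : ∀ p q : S.loops z, S.loopMatrix z w (g p) q ≤ S.M x p q := by
        intro p q
        have h1 := S.le_mul (z * rep ⟨g, hg⟩ * z) (z * w * z) p q (g p)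
        rw [← loopMatrix_apply z (rep ⟨g, hg⟩), hrep, if_pos rfl, one_mul] at h1
        exact h1
      have hMle : ∀ p r : S.loops z,
          ∑ q : S.loops z, (S.loopMatrix z w (g p) q : ℝ) * S.M u q r ≤ S.M (x * u) p r := by
        intro p r
        have h1 : ∑ q : S.loops z, S.loopMatrix z w (g p) q * S.M u q r ≤ S.M (x * u) p r :=
          (Finset.sum_le_sum fun q _ => Nat.mul_le_mul_right _ (hxle p q)).trans
            (sum_loops_le z x u p r)
        exact_mod_cast h1
      calc ∑ p, v p * h (m + 1) p
          ≤ ∑ p, v p * orbitAvg H (fun p => ∑ q, (S.loopMatrix z w p q : ℝ) * h m q) p :=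
            Finset.sum_le_sum fun p _ => mul_le_mul_of_nonneg_left (hstep m p) (hv p)
        _ ≤ ∑ p, v p * ∑ q, (S.loopMatrix z w (g p) q : ℝ) * h m q := hle
        _ = ∑ q, (∑ p, v p * (S.loopMatrix z w (g p) q : ℝ)) * h m q := by
            simp only [Finset.mul_sum, Finset.sum_mul]
            rw [Finset.sum_comm]
            exact Finset.sum_congr rfl fun _ _ => Finset.sum_congr rfl fun _ _ => by ring
        _ ≤ _ := hle'
        _ = ∑ p, ∑ r : S.loops z,
              v p * (∑ q : S.loops z, (S.loopMatrix z w (g p) q : ℝ) * S.M u q r) * h 0 r := by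
            simp only [Finset.mul_sum, Finset.sum_mul]
            refine Finset.sum_comm.trans (Eq.trans ?_ Finset.sum_comm)
            refine Finset.sum_congr rfl fun r _ => Finset.sum_comm.trans ?_
            exact Finset.sum_congr rfl fun _ _ => Finset.sum_congr rfl fun _ _ => by ring
        _ ≤ _ := by
            refine Finset.sum_le_sum fun p _ => Finset.sum_le_sum fun r _ => ?_
            exact mul_le_mul_of_nonneg_right (mul_le_mul_of_nonneg_left (hMle p r) (hv p)) (h0 r)

/-- With the unit vector at `a` for `v`, row `a` of the matrix of a word of length at most `C * m`
has sum at least `δ * m` over the loops, while `S.slow` makes each of these entries smaller than `δ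
* m` divided by the number of loops. -/
theorem false_of_growth (w : W) (h : ℕ → S.loops z → ℝ) (h0 : ∀ p, 0 ≤ h 0 p)
    (h1 : ∀ p, h 0 p ≤ 1)
    (hstep : ∀ j p, h (j + 1) p ≤ orbitAvg (S.loopGroup hzZ hz hmin)
      (fun p => ∑ q, (S.loopMatrix z w p q : ℝ) * h j q) p) (a : S.loops z) {δ : ℝ}
    (hδ : 0 < δ) (hgrow : ∀ m : ℕ, δ * m ≤ h m a) : False := by
  obtain ⟨C, hC⟩ := exists_word_of_growth w h h0 hstep
  have hk : (0 : ℝ) < (S.loops z).card := Nat.cast_pos.2 (Finset.card_pos.2 ⟨a, a.2⟩)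
  obtain ⟨m, hm⟩ := S.slow (δ / (S.loops z).card) (div_pos hδ hk) C
  obtain ⟨u, hu, hle⟩ := hC m (Pi.single a 1) fun p => by
    rw [Pi.single_apply]; split_ifs <;> norm_num
  have hlt := hm u (hu.trans (Nat.mul_le_mul_left _ (Nat.le_succ m))) a (mem_loops.1 a.2).1
  have hl : ∑ p, (Pi.single a 1 : S.loops z → ℝ) p * h m p = h m a := by
    rw [Finset.sum_eq_single a]
    · simp
    · intro q _ hq
      simp [hq]
    · simp
  have hr : ∑ p, ∑ q, (Pi.single a 1 : S.loops z → ℝ) p * (S.M u p.1 q.1 : ℝ) * h 0 q =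
      ∑ q : S.loops z, (S.M u a q : ℝ) * h 0 q := by
    rw [Finset.sum_eq_single a]
    · simp
    · intro q _ hq
      simp [hq]
    · simp
  rw [hl, hr] at hle
  have h2 : ∑ q : S.loops z, (S.M u a q : ℝ) * h 0 q <
      ∑ _q : S.loops z, δ / (S.loops z).card * m := by
    refine Finset.sum_lt_sum_of_nonempty ⟨a, Finset.mem_univ _⟩ fun q _ => ?_
    refine lt_of_le_of_lt ?_ (hlt q (mem_loops.1 q.2).1)
    exact mul_le_of_le_one_right (Nat.cast_nonneg _) (h1 q)
  rw [Finset.sum_const, Finset.card_univ, Fintype.card_coe, nsmul_eq_mul] at h2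
  have h3 : ((S.loops z).card : ℝ) * (δ / (S.loops z).card * m) = δ * m := by
    field_simp
  have := hgrow m
  linarith

end

end SlowRep

/-! ### The orbit trace separates. -/

namespace SlowRep

variable {W σ : Type*} [Monoid W] [Fintype σ] [DecidableEq σ] {S : SlowRep W σ}

/-- `p` and `q` are in the same orbit of `H`. -/
def SameOrbit {P : Type*} (H : Subgroup (Equiv.Perm P)) (p q : P) : Prop := ∃ g ∈ H, g p = q

section SameOrbit

variable {P : Type*} {H : Subgroup (Equiv.Perm P)}

theorem SameOrbit.refl (p : P) : SameOrbit H p p := ⟨1, H.one_mem, rfl⟩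

theorem SameOrbit.symm {p q : P} (h : SameOrbit H p q) : SameOrbit H q p := by
  obtain ⟨g, hg, rfl⟩ := h
  exact ⟨g⁻¹, H.inv_mem hg, by simp⟩

theorem SameOrbit.trans {p q r : P} (h : SameOrbit H p q) (h' : SameOrbit H q r) :
    SameOrbit H p r := by
  obtain ⟨g, hg, rfl⟩ := h
  obtain ⟨g', hg', rfl⟩ := h'
  exact ⟨g' * g, H.mul_mem hg' hg, rfl⟩

theorem sameOrbit_apply_iff {g : Equiv.Perm P} (hg : g ∈ H) {p q : P} :
    SameOrbit H (g p) q ↔ SameOrbit H p q :=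
  ⟨fun h => SameOrbit.trans ⟨g, hg, rfl⟩ h,
    fun h => SameOrbit.trans (SameOrbit.symm ⟨g, hg, rfl⟩) h⟩

end SameOrbit

open Classical in
/-- The number of runs on `z * w * z` between loops of `z` in the same orbit of `H`. -/
noncomputable def orbitTrace (S : SlowRep W σ) {z : W} (H : Subgroup (Equiv.Perm (S.loops z)))
    (w : W) : ℕ :=
  ∑ a, ∑ b, if SameOrbit H a b then S.loopMatrix z w a b else 0

variable {Z : Submonoid W} {z : W} {hzZ : z ∈ Z} {hz : S.IsIdem z}
  {hmin : ∀ v ∈ Z, S.IsIdem v → (S.loops z).card ≤ (S.loops v).card}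

theorem orbitTrace_eq_card {u : W} (hu : u ∈ Z) :
    S.orbitTrace (S.loopGroup hzZ hz hmin) u = (S.loops z).card := by
  classical
  obtain ⟨g, hg, h⟩ := exists_mem_loopGroup (hzZ := hzZ) (hz := hz) (hmin := hmin) hu
  have : ∀ a, (∑ b, if SameOrbit (S.loopGroup hzZ hz hmin) a b then S.loopMatrix z u a b else 0)
      = 1 := by
    intro a
    rw [Finset.sum_eq_single (g a)]
    · rw [if_pos ⟨g, hg, rfl⟩, h, if_pos rfl]
    · intro b _ hb
      rw [h, if_neg (Ne.symm hb), ite_self]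
    · simp
  rw [orbitTrace, Finset.sum_congr rfl fun a _ => this a]
  simp

/-- Let `n p` be the average over the orbit of `p` of the number of runs that stay in this orbit. If
the claim fails, these numbers have mean at least 1. Either some `n c` exceeds 1 and the runs inside
that orbit multiply, or all equal 1 and the crossing from the orbit of `a` to that of `b` can happen
in any round. Both give at least linear growth. -/
theorem orbitTrace_lt_card {w : W} {a b : S.loops z} (hab : 0 < S.loopMatrix z w a b)
    (hne : ¬ SameOrbit (S.loopGroup hzZ hz hmin) a b) :
    S.orbitTrace (S.loopGroup hzZ hz hmin) w < (S.loops z).card := by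
  classical
  set H := S.loopGroup hzZ hz hmin with hH
  by_contra! hcard
  let B : S.loops z → S.loops z → ℝ := fun p q => S.loopMatrix z w p q
  have hB : ∀ p q, 0 ≤ B p q := fun p q => Nat.cast_nonneg _
  let f : S.loops z → S.loops z → ℝ := fun c p => ∑ q, B p q * if SameOrbit H c q then 1 else 0
  have hind : ∀ c q : S.loops z, (0 : ℝ) ≤ if SameOrbit H c q then 1 else 0 := by
    intro c q
    split_ifs <;> norm_num
  have hf : ∀ c p, 0 ≤ f c p := fun c p =>
    Finset.sum_nonneg fun q _ => mul_nonneg (hB p q) (hind c q)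
  let n : S.loops z → ℝ := fun p => orbitAvg H (f p) p
  have hn : ∀ {c p}, SameOrbit H c p → orbitAvg H (f c) p = n p := by
    intro c p hcp
    refine orbitAvg_congr H fun g _ => Finset.sum_congr rfl fun q _ => ?_
    have : SameOrbit H c q ↔ SameOrbit H p q := ⟨hcp.symm.trans, hcp.trans⟩
    simp only [this]
  have hninv : ∀ {p q}, SameOrbit H p q → n q = n p := by
    rintro p q ⟨g, hg, rfl⟩
    rw [← hn ⟨g, hg, rfl⟩]
    exact orbitAvg_apply H _ ⟨g, hg⟩ p
  have hsum : ∑ p, n p = S.orbitTrace H w := by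
    have h1 : ∀ p, n p = orbitAvg H (fun p => f p p) p := by
      intro p
      refine orbitAvg_congr H fun g hg => Finset.sum_congr rfl fun q _ => ?_
      simp only [sameOrbit_apply_iff hg]
    rw [Finset.sum_congr rfl fun p _ => h1 p, sum_orbitAvg, orbitTrace]
    push_cast
    refine Finset.sum_congr rfl fun p _ => Finset.sum_congr rfl fun q _ => ?_
    split_ifs <;> simp [B]
  have hsum' : ((S.loops z).card : ℝ) ≤ ∑ p, n p := by
    rw [hsum]
    exact_mod_cast hcard
  by_cases hbig : ∃ c, 1 < n c
  · obtain ⟨c, hc⟩ := hbig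
    refine false_of_growth (hzZ := hzZ) (hz := hz) (hmin := hmin) w
      -- A linear lower bound for `(n c) ^ j`, by Bernoulli's inequality, is all that is needed.
      (fun j q => (if SameOrbit H c q then 1 else 0) * (1 + j * (n c - 1)))
      (fun p => ?_) (fun p => ?_) (fun j p => ?_) c (sub_pos.2 hc) (fun m => ?_)
    · split_ifs <;> norm_num
    · split_ifs <;> norm_num
    · have hpos : 0 ≤ 1 + (j : ℝ) * (n c - 1) := by
        have := mul_nonneg (Nat.cast_nonneg (α := ℝ) j) (sub_pos.2 hc).le
        linarith
      have h1 : ∀ p, ∑ q, (S.loopMatrix z w p q : ℝ) *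
          ((if SameOrbit H c q then 1 else 0) * (1 + j * (n c - 1))) =
            f c p * (1 + j * (n c - 1)) := by
        intro p
        simp only [f, B, Finset.sum_mul, mul_assoc]
      simp only [h1]
      rw [orbitAvg_mul]
      by_cases hcp : SameOrbit H c p
      · rw [if_pos hcp, hn hcp, hninv hcp]
        push_cast
        nlinarith [mul_nonneg (Nat.cast_nonneg (α := ℝ) j) (sq_nonneg (n c - 1))]
      · rw [if_neg hcp, zero_mul]
        exact mul_nonneg (orbitAvg_nonneg H (hf c) p) hpos
    · simp only [SameOrbit.refl, if_true]
      linarith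
  · push Not at hbig
    have hone : ∀ p, n p = 1 := by
      have h1 : ∑ p, (1 - n p) ≤ 0 := by
        rw [Finset.sum_sub_distrib]
        simp only [Finset.sum_const, Finset.card_univ, Fintype.card_coe, nsmul_eq_mul, mul_one]
        linarith
      have h2 := (Finset.sum_eq_zero_iff_of_nonneg fun p _ => sub_nonneg.2 (hbig p)).1
        (le_antisymm h1 (Finset.sum_nonneg fun p _ => sub_nonneg.2 (hbig p)))
      intro p
      have := h2 p (Finset.mem_univ p)
      linarith
    set β := orbitAvg H (f b) a with hβ
    have hβpos : 0 < β := by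
      refine orbitAvg_pos H (hf b) ?_
      refine Finset.sum_pos' (fun q _ => mul_nonneg (hB a q) (hind b q)) ⟨b, Finset.mem_univ _, ?_⟩
      rw [if_pos (SameOrbit.refl b), mul_one]
      exact Nat.cast_pos.2 hab
    refine false_of_growth (hzZ := hzZ) (hz := hz) (hmin := hmin) w
      -- The coefficient `j * β` collects the crossings in each of `j` rounds; the runs inside each
      -- orbit are preserved on average.
      (fun j q => (if SameOrbit H b q then 1 else 0) + (if SameOrbit H a q then 1 else 0) * (j * β))
      (fun p => ?_) (fun p => ?_) (fun j p => ?_) a hβpos (fun m => ?_)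
    · simp only [Nat.cast_zero, zero_mul, mul_zero, add_zero]
      exact hind b p
    · simp only [Nat.cast_zero, zero_mul, mul_zero, add_zero]
      split_ifs <;> norm_num
    · have h1 : ∀ p, ∑ q, (S.loopMatrix z w p q : ℝ) *
          ((if SameOrbit H b q then 1 else 0) +
            (if SameOrbit H a q then 1 else 0) * (j * β)) = f b p + f a p * (j * β) := by
        intro p
        simp only [f, B, Finset.sum_mul, mul_assoc, ← Finset.sum_add_distrib, mul_add]
      simp only [h1]
      have hjβ : 0 ≤ (j : ℝ) * β := mul_nonneg (Nat.cast_nonneg j) hβpos.le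
      rw [orbitAvg_add, orbitAvg_mul]
      have h2 := orbitAvg_nonneg H (hf b) p
      have h3 := mul_nonneg (orbitAvg_nonneg H (hf a) p) hjβ
      by_cases hap : SameOrbit H a p
      · have hbp : ¬ SameOrbit H b p := fun h => hne (hap.trans h.symm)
        have h4 : orbitAvg H (f b) p = β := by
          obtain ⟨g, hg, rfl⟩ := hap
          exact orbitAvg_apply H _ ⟨g, hg⟩ a
        rw [if_pos hap, if_neg hbp, hn hap, hone, h4]
        push_cast
        linarith
      · rw [if_neg hap, zero_mul, add_zero]
        by_cases hbp : SameOrbit H b p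
        · rw [if_pos hbp, hn hbp, hone]
          linarith
        · rw [if_neg hbp]
          linarith
    · simp only [SameOrbit.refl, if_true]
      rw [if_neg fun h => hne h.symm]
      linarith

variable (S) in
/-- There is a weighted sum of matrix entries that is constant on `Z`, and smaller on the words
that admit a run for which there is no run with the same ends on the words in `Z`. -/
theorem exists_separating_sum (Z : Submonoid W) :
    ∃ (z : W) (k : ℕ) (R : σ → σ → ℕ), z ∈ Z ∧ k ≤ Fintype.card σ ∧
      (∀ u ∈ Z, ∑ a, ∑ b, R a b * S.M (z * u * z) a b = k) ∧
      ∀ w, ∀ s ∈ S.useful, ∀ f ∈ S.useful, (∀ u ∈ Z, S.M u s f = 0) →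
        0 < S.M (z * w * z) s f → ∑ a, ∑ b, R a b * S.M (z * w * z) a b < k := by
  classical
  obtain ⟨z, hzZ, hz, hmin⟩ := S.exists_isIdem_min Z
  set H := S.loopGroup hzZ hz hmin with hH
  let R : σ → σ → ℕ := fun a b =>
    if h : a ∈ S.loops z ∧ b ∈ S.loops z then if SameOrbit H ⟨a, h.1⟩ ⟨b, h.2⟩ then 1 else 0
    else 0
  have hR : ∀ w, ∑ a, ∑ b, R a b * S.M (z * w * z) a b = S.orbitTrace H w := by
    intro w
    rw [orbitTrace, ← Finset.sum_subset (Finset.subset_univ (S.loops z)),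
      ← Finset.sum_coe_sort (S.loops z)]
    · refine Finset.sum_congr rfl fun a _ => ?_
      rw [← Finset.sum_subset (Finset.subset_univ (S.loops z)), ← Finset.sum_coe_sort (S.loops z)]
      · refine Finset.sum_congr rfl fun b _ => ?_
        simp only [R, a.2, b.2, and_self, dite_true, loopMatrix_apply]
        split_ifs <;> simp
      · intro b _ hb
        simp [R, hb]
    · intro a _ ha
      simp [R, ha]
  refine ⟨z, (S.loops z).card, R, hzZ, Finset.card_le_univ _, fun u hu => ?_, ?_⟩
  · rw [hR, orbitTrace_eq_card hu]
  · intro w s hs f hf hZ hpos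
    rw [hR]
    obtain ⟨y, hy, hyf⟩ := S.pos_mul_iff.1 hpos
    obtain ⟨x, hsx, hxy⟩ := S.pos_mul_iff.1 hy
    obtain ⟨a, ha1, ha2, ha3⟩ := hz.exists_loop hsx
    obtain ⟨b, hb1, hb2, hb3⟩ := hz.exists_loop hyf
    have hab : 0 < S.M (z * w * z) a b := S.pos_mul (S.pos_mul ha3 hxy) hb1
    have haU : a ∈ S.useful := S.convex hs hf ha1 (S.pos_mul hab hb3)
    have hbU : b ∈ S.useful := S.convex hs hf (S.pos_mul ha1 hab) hb3
    refine orbitTrace_lt_card (a := ⟨a, mem_loops.2 ⟨haU, ha2⟩⟩)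
      (b := ⟨b, mem_loops.2 ⟨hbU, hb2⟩⟩) hab ?_
    -- In a common orbit, some `z * u * z` with `u` in `Z` would lead from `a` to `b`, giving a word
    -- of `Z` with a run from `s` to `f`.
    rintro ⟨g, hg, hgab⟩
    obtain ⟨u, hu, hug⟩ := mem_loopGroup.1 hg
    have h1 := hug ⟨a, mem_loops.2 ⟨haU, ha2⟩⟩ ⟨b, mem_loops.2 ⟨hbU, hb2⟩⟩
    rw [if_pos hgab, loopMatrix_apply] at h1
    have h2 : 0 < S.M (z * (z * u * z) * z) s f :=
      S.pos_mul (S.pos_mul ha1 (by rw [h1]; exact one_pos)) hb3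
    rw [hZ _ (Z.mul_mem (Z.mul_mem hzZ (Z.mul_mem (Z.mul_mem hzZ hu) hzZ)) hzZ)] at h2
    exact lt_irrefl _ h2

end SlowRep

/-! ### Hard distributions for intersecting graphs of functions. -/

/-- A distribution `one` on the pairs in the relation `I` and a measure `zero` on the other pairs,
with bounded marginals, such that every large rectangle has a substantial part of its `zero`
measure also in the measure `one`. -/
structure HardPair (X : Type*) [Fintype X] (I : X → X → Prop) (η : ℝ) where
  /-- The distribution on the related pairs. -/
  one : X → X → ℝ
  /-- The measure on the unrelated pairs. -/
  zero : X → X → ℝ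
  one_nonneg : ∀ x y, 0 ≤ one x y
  zero_nonneg : ∀ x y, 0 ≤ zero x y
  one_eq_zero : ∀ x y, ¬ I x y → one x y = 0
  zero_eq_zero : ∀ x y, I x y → zero x y = 0
  sum_one : ∑ x, ∑ y, one x y = 1
  half_le_sum_zero : 1 / 2 ≤ ∑ x, ∑ y, zero x y
  sum_zero_le : ∑ x, ∑ y, zero x y ≤ 1
  one_row : ∀ x, ∑ y, one x y ≤ 1 / Fintype.card X
  one_col : ∀ y, ∑ x, one x y ≤ 1 / Fintype.card X
  zero_row : ∀ x, ∑ y, zero x y ≤ 1 / Fintype.card X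
  zero_col : ∀ y, ∑ x, zero x y ≤ 1 / Fintype.card X
  rectangle : ∀ A B : Finset X, η * Fintype.card X < A.card → η * Fintype.card X < B.card →
    1 / 16 * ∑ x ∈ A, ∑ y ∈ B, zero x y ≤ ∑ x ∈ A, ∑ y ∈ B, one x y

section Functions

variable {ι V : Type*} [Fintype ι] [DecidableEq ι] [Fintype V] [DecidableEq V]

/-- A set of functions that meets the sets `T j` less often than half of what is expected is
small. -/
theorem card_le_of_rare [Nonempty V] (A : Finset (ι → V)) (J : Finset ι) (T : ι → Finset V)
    (h : ∀ j ∈ J, 2 * ((A.filter fun x => x j ∈ T j).card : ℝ) ≤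
      A.card * ((T j).card / Fintype.card V)) :
    (A.card : ℝ) ≤ Fintype.card (ι → V) *
      Real.exp (-(1 / 10) * ∑ j ∈ J, ((T j).card / Fintype.card V : ℝ)) := by
  have hm : (0 : ℝ) < Fintype.card V := Nat.cast_pos.2 Fintype.card_pos
  set τ : ι → ℝ := fun j => (T j).card / Fintype.card V with hτ
  set σ := ∑ j ∈ J, τ j with hσ
  let H : (ι → V) → ℝ := fun x => ∑ j ∈ J, if x j ∈ T j then 1 else 0
  have hH : ∑ x ∈ A, H x ≤ A.card * (σ / 2) := by
    have h1 : ∑ x ∈ A, H x = ∑ j ∈ J, ((A.filter fun x => x j ∈ T j).card : ℝ) := by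
      simp only [H]
      rw [Finset.sum_comm]
      exact Finset.sum_congr rfl fun j _ => by rw [Finset.sum_boole]
    rw [h1, hσ, Finset.sum_div, Finset.mul_sum]
    refine Finset.sum_le_sum fun j hj => ?_
    have := h j hj
    linarith
  -- Jensen's inequality, by the tangent of `exp` at `-(σ / 2)`; the mean of `H` on `A` is at most
  -- `σ / 2`.
  have hlow : Real.exp (-(σ / 2)) * A.card ≤ ∑ x ∈ A, Real.exp (-H x) := by
    have h1 : ∀ x ∈ A, Real.exp (-(σ / 2)) * (1 + σ / 2 - H x) ≤ Real.exp (-H x) := by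
      intro x _
      have h2 := Real.add_one_le_exp (σ / 2 - H x)
      have h3 : Real.exp (-H x) = Real.exp (-(σ / 2)) * Real.exp (σ / 2 - H x) := by
        rw [← Real.exp_add]
        congr 1
        ring
      rw [h3]
      exact mul_le_mul_of_nonneg_left (by linarith) (Real.exp_pos _).le
    refine le_trans ?_ (Finset.sum_le_sum h1)
    rw [← Finset.mul_sum, Finset.sum_sub_distrib, Finset.sum_const, nsmul_eq_mul]
    exact mul_le_mul_of_nonneg_left (by linarith) (Real.exp_pos _).le
  -- Over all functions the coordinates are independent, so the exponential moment factors, and `1 -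
  -- exp (-1) ≥ 3 / 5`. The surplus `3 / 5 - 1 / 2` is the `1 / 10` of the claim.
  have hup : ∑ x ∈ A, Real.exp (-H x) ≤
      Fintype.card (ι → V) * Real.exp (-(3 / 5) * σ) := by
    let φ : ι → V → ℝ := fun j a => if j ∈ J then (if a ∈ T j then Real.exp (-1) else 1) else 1
    have h1 : ∀ x : ι → V, Real.exp (-H x) = ∏ j, φ j (x j) := by
      intro x
      simp only [φ, H]
      rw [Finset.prod_ite_mem, Finset.univ_inter, ← Finset.sum_neg_distrib, Real.exp_sum]
      refine Finset.prod_congr rfl fun j _ => ?_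
      split_ifs <;> simp
    have he : Real.exp (-1) ≤ 2 / 5 := by
      have h2 := Real.exp_one_gt_d9
      rw [Real.exp_neg, inv_le_comm₀ (Real.exp_pos 1) (by norm_num)]
      norm_num
      linarith
    have h2 : ∀ j, ∑ a, φ j a ≤ Fintype.card V *
        Real.exp (-(3 / 5) * if j ∈ J then τ j else 0) := by
      intro j
      simp only [φ]
      split_ifs with hj
      · have h3 : ∑ a : V, (if a ∈ T j then Real.exp (-1) else 1) =
            (T j).card * Real.exp (-1) + (Fintype.card V - (T j).card) := by
          have : ∀ a : V, (if a ∈ T j then Real.exp (-1) else 1) =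
              1 - (if a ∈ T j then (1 - Real.exp (-1)) else 0) := by
            intro a
            split_ifs <;> ring
          simp only [this]
          rw [Finset.sum_sub_distrib, Finset.sum_ite_mem, Finset.univ_inter]
          simp only [Finset.sum_const, Finset.card_univ, nsmul_eq_mul]
          ring
        rw [h3]
        have h4 := Real.add_one_le_exp (-(3 / 5) * τ j)
        have h5 : (Fintype.card V : ℝ) * (-(3 / 5) * τ j + 1) =
            (T j).card * (2 / 5) + (Fintype.card V - (T j).card) := by
          simp only [hτ]
          field_simp
          ring
        calc _ ≤ ((T j).card : ℝ) * (2 / 5) + (Fintype.card V - (T j).card) := by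
              have := mul_le_mul_of_nonneg_left he (Nat.cast_nonneg (α := ℝ) (T j).card)
              linarith
          _ = _ := h5.symm
          _ ≤ _ := mul_le_mul_of_nonneg_left h4 hm.le
      · simp
    calc ∑ x ∈ A, Real.exp (-H x) ≤ ∑ x, Real.exp (-H x) :=
          Finset.sum_le_univ_sum_of_nonneg fun x => (Real.exp_pos _).le
      _ = ∏ j, ∑ a, φ j a := by
          rw [Finset.prod_univ_sum, Fintype.piFinset_univ]
          exact Finset.sum_congr rfl fun x _ => h1 x
      _ ≤ ∏ j, (Fintype.card V * Real.exp (-(3 / 5) * if j ∈ J then τ j else 0)) := by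
          refine Finset.prod_le_prod (fun j _ => Finset.sum_nonneg fun a _ => ?_) fun j _ => h2 j
          simp only [φ]
          split_ifs <;> first | exact (Real.exp_pos _).le | norm_num
      _ = _ := by
          rw [Finset.prod_mul_distrib, ← Real.exp_sum, ← Finset.mul_sum, Finset.sum_ite_mem,
            Finset.univ_inter]
          simp [hσ]
  have h1 := hlow.trans hup
  calc (A.card : ℝ) = Real.exp (σ / 2) * (Real.exp (-(σ / 2)) * A.card) := by
        rw [← mul_assoc, ← Real.exp_add]
        simp
    _ ≤ Real.exp (σ / 2) * (Fintype.card (ι → V) * Real.exp (-(3 / 5) * σ)) :=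
        mul_le_mul_of_nonneg_left h1 (Real.exp_pos _).le
    _ = _ := by
        rw [mul_left_comm, ← Real.exp_add]
        congr 2
        ring

/-- The values at `j` that occur in `A` less than half as often as expected. -/
def lightValues (A : Finset (ι → V)) (j : ι) : Finset V :=
  Finset.univ.filter fun a => 2 * Fintype.card V * (A.filter fun x => x j = a).card < A.card

/-- The coordinates with many light values. -/
def lightCoords (A : Finset (ι → V)) : Finset ι :=
  Finset.univ.filter fun j => Fintype.card V < 4 * (lightValues A j).card

/-- A quarter of the coordinates, each with a light fraction above 1/4, would make the sum in
`card_le_of_rare` at least `|ι| / 16`; with the factor `1 / 10` this gives 160. -/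
theorem card_lightCoords_lt [Nonempty V] (A : Finset (ι → V))
    (hA : Real.exp (-(Fintype.card ι / 160)) * Fintype.card (ι → V) < A.card) :
    4 * (lightCoords A).card < Fintype.card ι := by
  by_contra! hcard
  have hm : (0 : ℝ) < Fintype.card V := Nat.cast_pos.2 Fintype.card_pos
  have h := card_le_of_rare A (lightCoords A) (lightValues A) fun j _ => by
    have h1 : (A.filter fun x => x j ∈ lightValues A j).card =
        ∑ a ∈ lightValues A j, (A.filter fun x => x j = a).card := by
      rw [Finset.card_eq_sum_card_fiberwise (f := fun x => x j) (t := lightValues A j)]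
      · refine Finset.sum_congr rfl fun a ha => ?_
        congr 1
        ext x
        simp only [Finset.mem_filter]
        constructor
        · rintro ⟨⟨hx, -⟩, hxa⟩
          exact ⟨hx, hxa⟩
        · rintro ⟨hx, hxa⟩
          exact ⟨⟨hx, hxa ▸ ha⟩, hxa⟩
      · intro x hx
        exact (Finset.mem_filter.1 hx).2
    have h2 : 2 * Fintype.card V * (A.filter fun x => x j ∈ lightValues A j).card ≤
        (lightValues A j).card * A.card := by
      rw [h1, Finset.mul_sum, ← smul_eq_mul (lightValues A j).card]
      exact Finset.sum_le_card_nsmul _ _ _ fun a ha => (Finset.mem_filter.1 ha).2.le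
    have h3 : (2 : ℝ) * Fintype.card V * (A.filter fun x => x j ∈ lightValues A j).card ≤
        (lightValues A j).card * A.card := by exact_mod_cast h2
    rw [mul_div_assoc', le_div_iff₀ hm]
    linarith
  refine absurd (h.trans ?_) (not_le.2 hA)
  rw [mul_comm]
  refine mul_le_mul_of_nonneg_right (Real.exp_le_exp.2 ?_) (Nat.cast_nonneg _)
  have h1 : ((lightCoords A).card : ℝ) * (1 / 4) ≤
      ∑ j ∈ lightCoords A, ((lightValues A j).card / Fintype.card V : ℝ) := by
    rw [← nsmul_eq_mul]
    refine Finset.card_nsmul_le_sum _ _ _ fun j hj => ?_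
    rw [le_div_iff₀ hm]
    have : (Fintype.card V : ℝ) < 4 * (lightValues A j).card := by
      exact_mod_cast (Finset.mem_filter.1 hj).2
    linarith
  have h2 : (Fintype.card ι : ℝ) ≤ 4 * (lightCoords A).card := by exact_mod_cast hcard
  linarith

/-- The number of coordinates at which `x` and `y` agree. -/
def agreement (x y : ι → V) : ℕ := (Finset.univ.filter fun j => x j = y j).card

omit [DecidableEq ι] [Fintype V] in
theorem agreement_comm (x y : ι → V) : agreement x y = agreement y x := by
  simp only [agreement, eq_comm]

omit [DecidableEq ι] in
theorem sum_agreement (A B : Finset (ι → V)) :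
    ∑ x ∈ A, ∑ y ∈ B, agreement x y =
      ∑ j, ∑ a, (A.filter fun x => x j = a).card * (B.filter fun y => y j = a).card := by
  have h1 : ∀ x y : ι → V, agreement x y =
      ∑ j, ∑ a, (if x j = a then 1 else 0) * (if y j = a then 1 else 0) := by
    intro x y
    rw [agreement, Finset.card_filter]
    refine Finset.sum_congr rfl fun j _ => ?_
    simp [eq_comm]
  simp only [h1, Finset.card_filter, Finset.sum_mul_sum]
  rw [Finset.sum_congr rfl fun x _ => Finset.sum_comm, Finset.sum_comm]
  refine Finset.sum_congr rfl fun j _ => ?_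
  rw [Finset.sum_congr rfl fun x _ => Finset.sum_comm, Finset.sum_comm]

/-- At least half of the coordinates are light for neither set, and at such a coordinate at least
half of the values are light for neither. Each such value is taken on at least a fraction `1 / (2
|V|)` of `A` and of `B`. The losses `2 * 2 * 4` make up the 16. -/
theorem le_sum_agreement [Nonempty V] (A B : Finset (ι → V))
    (hA : Real.exp (-(Fintype.card ι / 160)) * Fintype.card (ι → V) < A.card)
    (hB : Real.exp (-(Fintype.card ι / 160)) * Fintype.card (ι → V) < B.card) :
    (Fintype.card ι : ℝ) * (A.card * B.card) ≤
      16 * Fintype.card V * ((∑ x ∈ A, ∑ y ∈ B, agreement x y : ℕ) : ℝ) := by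
  have hm : (0 : ℝ) < Fintype.card V := Nat.cast_pos.2 Fintype.card_pos
  rw [sum_agreement]
  push_cast
  let G : Finset ι := (lightCoords A ∪ lightCoords B)ᶜ
  have hG : (Fintype.card ι : ℝ) ≤ 2 * G.card := by
    have h1 := card_lightCoords_lt A hA
    have h2 := card_lightCoords_lt B hB
    have h3 := Finset.card_union_le (lightCoords A) (lightCoords B)
    have h4 := Finset.card_compl_add_card (lightCoords A ∪ lightCoords B)
    have : Fintype.card ι ≤ 2 * G.card := by
      change _ ≤ 2 * ((lightCoords A ∪ lightCoords B)ᶜ).card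
      omega
    exact_mod_cast this
  have hterm : ∀ j ∈ G, (A.card * B.card : ℝ) / (8 * Fintype.card V) ≤
      ∑ a, ((A.filter fun x => x j = a).card : ℝ) * (B.filter fun y => y j = a).card := by
    intro j hj
    have hj' : j ∉ lightCoords A ∧ j ∉ lightCoords B := by
      simpa [G, not_or] using hj
    simp only [lightCoords, Finset.mem_filter, Finset.mem_univ, true_and, not_lt] at hj'
    let F : Finset V := (lightValues A j ∪ lightValues B j)ᶜ
    have hF : (Fintype.card V : ℝ) ≤ 2 * F.card := by
      have h3 := Finset.card_union_le (lightValues A j) (lightValues B j)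
      have h4 := Finset.card_compl_add_card (lightValues A j ∪ lightValues B j)
      have : Fintype.card V ≤ 2 * F.card := by
        change _ ≤ 2 * ((lightValues A j ∪ lightValues B j)ᶜ).card
        omega
      exact_mod_cast this
    have hval : ∀ a ∈ F, (A.card * B.card : ℝ) / (4 * Fintype.card V ^ 2) ≤
        ((A.filter fun x => x j = a).card : ℝ) * (B.filter fun y => y j = a).card := by
      intro a ha
      have ha' : a ∉ lightValues A j ∧ a ∉ lightValues B j := by simpa [F, not_or] using ha
      simp only [lightValues, Finset.mem_filter, Finset.mem_univ, true_and, not_lt] at ha'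
      have h1 : (A.card : ℝ) ≤ 2 * Fintype.card V * (A.filter fun x => x j = a).card := by
        exact_mod_cast ha'.1
      have h2 : (B.card : ℝ) ≤ 2 * Fintype.card V * (B.filter fun x => x j = a).card := by
        exact_mod_cast ha'.2
      rw [div_le_iff₀ (by positivity)]
      refine (mul_le_mul h1 h2 (Nat.cast_nonneg _) (by positivity)).trans (le_of_eq ?_)
      ring
    calc (A.card * B.card : ℝ) / (8 * Fintype.card V)
        = (Fintype.card V / 2) * ((A.card * B.card : ℝ) / (4 * Fintype.card V ^ 2)) := by
          field_simp
          ring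
      _ ≤ F.card * ((A.card * B.card : ℝ) / (4 * Fintype.card V ^ 2)) :=
          mul_le_mul_of_nonneg_right (by linarith) (by positivity)
      _ ≤ ∑ a ∈ F, ((A.filter fun x => x j = a).card : ℝ) * (B.filter fun y => y j = a).card := by
          rw [← nsmul_eq_mul]
          exact Finset.card_nsmul_le_sum _ _ _ hval
      _ ≤ _ := Finset.sum_le_univ_sum_of_nonneg fun a => by positivity
  have h5 : (G.card : ℝ) * ((A.card * B.card : ℝ) / (8 * Fintype.card V)) ≤
      ∑ j, ∑ a, ((A.filter fun x => x j = a).card : ℝ) * (B.filter fun y => y j = a).card := by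
    rw [← nsmul_eq_mul]
    exact (Finset.card_nsmul_le_sum _ _ _ hterm).trans
      (Finset.sum_le_univ_sum_of_nonneg fun j => Finset.sum_nonneg fun a _ => by positivity)
  calc (Fintype.card ι : ℝ) * (A.card * B.card) ≤ (2 * G.card) * (A.card * B.card) :=
        mul_le_mul_of_nonneg_right hG (by positivity)
    _ = 16 * Fintype.card V * (G.card * ((A.card * B.card : ℝ) / (8 * Fintype.card V))) := by
        field_simp
        ring
    _ ≤ _ := mul_le_mul_of_nonneg_left h5 (by positivity)

theorem card_mul_card_filter_apply_eq (j : ι) (a : V) :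
    Fintype.card V * (Finset.univ.filter fun x : ι → V => x j = a).card =
      Fintype.card (ι → V) := by
  have h : (Finset.univ.filter fun x : ι → V => x j = a) =
      Fintype.piFinset (Function.update (fun _ => (Finset.univ : Finset V)) j {a}) := by
    ext x
    simp only [Finset.mem_filter, Finset.mem_univ, true_and, Fintype.mem_piFinset]
    constructor
    · rintro rfl i
      by_cases hi : i = j
      · subst hi; simp
      · simp [hi]
    · intro h
      simpa using h j
  have h2 : ∏ i, (Function.update (fun _ => (Finset.univ : Finset V)) j {a} i).card =
      ∏ i ∈ Finset.univ.erase j, Fintype.card V := by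
    rw [← Finset.mul_prod_erase _ _ (Finset.mem_univ j)]
    simp only [Function.update_self, Finset.card_singleton, one_mul]
    refine Finset.prod_congr rfl fun i hi => ?_
    rw [Function.update_of_ne (Finset.ne_of_mem_erase hi), Finset.card_univ]
  rw [h, Fintype.card_piFinset, h2, Finset.mul_prod_erase
    (f := fun _ => Fintype.card V) _ (Finset.mem_univ j)]
  simp

theorem card_mul_sum_agreement (x : ι → V) :
    Fintype.card V * ∑ y, agreement x y = Fintype.card ι * Fintype.card (ι → V) := by
  have h : ∑ y, agreement x y = ∑ j, (Finset.univ.filter fun y : ι → V => y j = x j).card := by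
    simp only [agreement, Finset.card_filter]
    rw [Finset.sum_comm]
    simp only [eq_comm]
  rw [h, Finset.mul_sum, Finset.sum_congr rfl fun j _ => card_mul_card_filter_apply_eq j (x j)]
  simp

/-- The hard pair of distributions for functions that agree somewhere. -/
noncomputable def hardPair [Nonempty ι] [Nonempty V]
    (hcard : 2 * Fintype.card ι ≤ Fintype.card V) :
    HardPair (ι → V) (fun x y => ∃ j, x j = y j) (Real.exp (-(Fintype.card ι / 160))) := by
  have hm : (0 : ℝ) < Fintype.card V := Nat.cast_pos.2 Fintype.card_pos
  have hr : (0 : ℝ) < Fintype.card ι := Nat.cast_pos.2 Fintype.card_pos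
  have hN : (0 : ℝ) < Fintype.card (ι → V) := Nat.cast_pos.2 Fintype.card_pos
  have hrow : ∀ x : ι → V, ∑ y, (Fintype.card V * agreement x y /
      (Fintype.card ι * Fintype.card (ι → V) ^ 2) : ℝ) = 1 / Fintype.card (ι → V) := by
    intro x
    have h : (Fintype.card V : ℝ) * ∑ y, (agreement x y : ℝ) =
        Fintype.card ι * Fintype.card (ι → V) := by
      exact_mod_cast card_mul_sum_agreement x
    rw [← Finset.sum_div, ← Finset.mul_sum, h]
    field_simp
  have hzrow : ∀ x : ι → V, ∑ y, (if agreement x y = 0 then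
      1 / (Fintype.card (ι → V) : ℝ) ^ 2 else 0) ≤ 1 / (Fintype.card (ι → V) : ℝ) := by
    intro x
    calc ∑ y, (if agreement x y = 0 then 1 / (Fintype.card (ι → V) : ℝ) ^ 2 else 0)
          ≤ ∑ _y : ι → V, 1 / (Fintype.card (ι → V) : ℝ) ^ 2 := by
          refine Finset.sum_le_sum fun y _ => ?_
          split_ifs
          · exact le_rfl
          · positivity
      _ = _ := by
          rw [Finset.sum_const, Finset.card_univ, nsmul_eq_mul]
          field_simp
  have hzero : ∀ x y : ι → V, (∃ j, x j = y j) ↔ agreement x y ≠ 0 := by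
    intro x y
    simp [agreement, Finset.filter_eq_empty_iff]
  exact
  { one := fun x y => Fintype.card V * agreement x y /
      (Fintype.card ι * Fintype.card (ι → V) ^ 2)
    zero := fun x y => if agreement x y = 0 then 1 / (Fintype.card (ι → V) : ℝ) ^ 2 else 0
    one_nonneg := fun x y => by positivity
    zero_nonneg := fun x y => by split_ifs <;> positivity
    one_eq_zero := fun x y h => by
      rw [hzero, not_not] at h
      simp [h]
    zero_eq_zero := fun x y h => if_neg ((hzero x y).1 h)
    sum_one := by
      rw [Finset.sum_congr rfl fun x _ => hrow x, Finset.sum_const, Finset.card_univ,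
        nsmul_eq_mul]
      field_simp
    half_le_sum_zero := by
      -- Markov's inequality: the mean agreement is `|ι| / |V| ≤ 1 / 2`.
      have h1 : ∀ x y : ι → V, (1 - (agreement x y : ℝ)) / (Fintype.card (ι → V) : ℝ) ^ 2 ≤
          if agreement x y = 0 then 1 / (Fintype.card (ι → V) : ℝ) ^ 2 else 0 := by
        intro x y
        split_ifs with h
        · simp [h]
        · have : (1 : ℝ) ≤ agreement x y := by exact_mod_cast Nat.pos_of_ne_zero h
          exact div_nonpos_of_nonpos_of_nonneg (by linarith) (by positivity)
      refine le_trans ?_ (Finset.sum_le_sum fun x _ => Finset.sum_le_sum fun y _ => h1 x y)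
      have h2 : ∀ x : ι → V, ∑ y, (1 - (agreement x y : ℝ)) / (Fintype.card (ι → V) : ℝ) ^ 2 =
          (1 - (Fintype.card ι : ℝ) / Fintype.card V) / (Fintype.card (ι → V) : ℝ) := by
        intro x
        have h : (Fintype.card V : ℝ) * ∑ y, (agreement x y : ℝ) =
            Fintype.card ι * Fintype.card (ι → V) := by
          exact_mod_cast card_mul_sum_agreement x
        have h' : ∑ y, (agreement x y : ℝ) =
            Fintype.card ι * Fintype.card (ι → V) / Fintype.card V := by
          rw [eq_div_iff hm.ne', ← h]
          ring
        rw [← Finset.sum_div, Finset.sum_sub_distrib, h']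
        simp only [Finset.sum_const, Finset.card_univ, nsmul_eq_mul, mul_one]
        field_simp
      rw [Finset.sum_congr rfl fun x _ => h2 x, Finset.sum_const, Finset.card_univ, nsmul_eq_mul,
        mul_div_cancel₀ _ hN.ne']
      have h3 : (Fintype.card ι : ℝ) / Fintype.card V ≤ 1 / 2 := by
        rw [div_le_iff₀ hm]
        have : (2 : ℝ) * Fintype.card ι ≤ Fintype.card V := by exact_mod_cast hcard
        linarith
      linarith
    sum_zero_le := by
      refine (Finset.sum_le_sum fun x _ => hzrow x).trans ?_
      rw [Finset.sum_const, Finset.card_univ, nsmul_eq_mul]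
      exact le_of_eq (by field_simp)
    one_row := fun x => (hrow x).le
    one_col := fun y => by
      simp only [agreement_comm _ y]
      exact (hrow y).le
    zero_row := hzrow
    zero_col := fun y => by
      simp only [agreement_comm _ y]
      exact hzrow y
    rectangle := by
      intro A B hA hB
      have h := le_sum_agreement A B hA hB
      push_cast at h
      have h1 : ∑ x ∈ A, ∑ y ∈ B, (if agreement x y = 0 then
          1 / (Fintype.card (ι → V) : ℝ) ^ 2 else 0) ≤
            A.card * B.card / (Fintype.card (ι → V) : ℝ) ^ 2 := by
        calc _ ≤ ∑ _x ∈ A, ∑ _y ∈ B, 1 / (Fintype.card (ι → V) : ℝ) ^ 2 := by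
              refine Finset.sum_le_sum fun x _ => Finset.sum_le_sum fun y _ => ?_
              split_ifs
              · exact le_rfl
              · positivity
          _ = _ := by
              simp only [Finset.sum_const, nsmul_eq_mul]
              ring
      simp only [← Finset.sum_div, ← Finset.mul_sum]
      rw [le_div_iff₀ (by positivity)]
      calc _ ≤ 1 / 16 * (A.card * B.card / (Fintype.card (ι → V) : ℝ) ^ 2) *
              (Fintype.card ι * Fintype.card (ι → V) ^ 2) := by
            refine mul_le_mul_of_nonneg_right (mul_le_mul_of_nonneg_left h1 (by norm_num))
              (by positivity)
        _ = 1 / 16 * (Fintype.card ι * (A.card * B.card)) := by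
            field_simp
        _ ≤ _ := by linarith }

end Functions

/-! ### Products of measures and of matrices. -/

/-- Expansion of the power of a weighted sum of matrices. -/
theorem sum_prod_smul_ofFn_prod {Ω σ : Type*} [Fintype Ω] [Fintype σ] [DecidableEq σ]
    (ν : Ω → ℝ) (G : Ω → Matrix σ σ ℝ) (t : ℕ) :
    ∑ ω : Fin t → Ω, (∏ i, ν (ω i)) • (List.ofFn fun i => G (ω i)).prod =
      (∑ w, ν w • G w) ^ t := by
  induction t with
  | zero => simp
  | succ t ih =>
    rw [pow_succ', ← ih, Finset.sum_mul_sum,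
      ← Equiv.sum_comp (Fin.consEquiv fun _ : Fin (t + 1) => Ω), Fintype.sum_prod_type]
    refine Finset.sum_congr rfl fun w _ => Finset.sum_congr rfl fun ω _ => ?_
    simp only [Fin.consEquiv, Equiv.coe_fn_mk, Fin.prod_univ_succ, List.ofFn_succ, Fin.cons_zero,
      Fin.cons_succ, List.prod_cons, smul_mul_smul_comm]

theorem ofFn_prod_mono {σ : Type*} [Fintype σ] [DecidableEq σ] {t : ℕ}
    (A B : Fin t → Matrix σ σ ℝ) (h0 : ∀ i a b, 0 ≤ A i a b) (h : ∀ i a b, A i a b ≤ B i a b)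
    (a b : σ) : 0 ≤ (List.ofFn A).prod a b ∧ (List.ofFn A).prod a b ≤ (List.ofFn B).prod a b := by
  induction t generalizing a with
  | zero =>
    simp only [List.ofFn_zero, List.prod_nil, le_refl, and_true, Matrix.one_apply]
    split_ifs <;> norm_num
  | succ t ih =>
    simp only [List.ofFn_succ, List.prod_cons, Matrix.mul_apply]
    have ih' := ih (fun i => A i.succ) (fun i => B i.succ) (fun i => h0 i.succ) fun i => h i.succ
    exact ⟨Finset.sum_nonneg fun c _ => mul_nonneg (h0 _ _ _) (ih' c).1,
      Finset.sum_le_sum fun c _ => mul_le_mul (h _ _ _) (ih' c).2 (ih' c).1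
        ((h0 _ _ _).trans (h _ _ _))⟩

/-- The sum factors over the coordinates, and each coordinate other than `i` contributes at most 2.
-/
theorem sum_prod_mul_indicator_le {Ω : Type*} [Fintype Ω] {t : ℕ} (μ : Ω → ℝ)
    (hμ : ∀ w, 0 ≤ μ w) (h2 : ∑ w, μ w ≤ 2) (E : Ω → ℝ) (hE : ∀ w, 0 ≤ E w) (i : Fin t) :
    ∑ ω : Fin t → Ω, (∏ j, μ (ω j)) * E (ω i) ≤ 2 ^ t * ∑ w, μ w * E w := by
  classical
  have h1 : ∀ ω : Fin t → Ω, (∏ j, μ (ω j)) * E (ω i) =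
      ∏ j, (μ (ω j) * if j = i then E (ω j) else 1) := by
    intro ω
    rw [Finset.prod_mul_distrib]
    congr 1
    rw [Finset.prod_eq_single i]
    · simp
    · intro j _ hj
      simp [hj]
    · simp
  have h3 := Finset.prod_univ_sum (fun _ : Fin t => (Finset.univ : Finset Ω))
    (fun j w => μ w * if j = i then E w else 1)
  rw [Fintype.piFinset_univ] at h3
  rw [Finset.sum_congr rfl fun ω _ => h1 ω, ← h3,
    ← Finset.mul_prod_erase _ _ (Finset.mem_univ i), mul_comm]
  simp only [if_true]
  have h4 : 0 ≤ ∑ w, μ w * E w := Finset.sum_nonneg fun w _ => mul_nonneg (hμ w) (hE w)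
  refine mul_le_mul_of_nonneg_right ?_ h4
  calc ∏ j ∈ Finset.univ.erase i, ∑ w, μ w * (if j = i then E w else 1)
      = ∏ j ∈ Finset.univ.erase i, ∑ w, μ w := by
        refine Finset.prod_congr rfl fun j hj => ?_
        simp [Finset.ne_of_mem_erase hj]
    _ ≤ ∏ _j ∈ Finset.univ.erase i, (2 : ℝ) :=
        Finset.prod_le_prod (fun _ _ => Finset.sum_nonneg fun w _ => hμ w) fun _ _ => h2
    _ ≤ 2 ^ t := by
        rw [Finset.prod_const]
        refine pow_le_pow_right₀ (by norm_num) ?_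
        exact (Finset.card_le_univ _).trans (by simp)

/-! ### Pruned transitions and the product of the signed measure. -/

namespace HardPair

variable {X σ : Type*} [Fintype X] [Fintype σ] [DecidableEq σ] {I : X → X → Prop} {η : ℝ}

open Classical in
/-- The transitions `P x`, without those that are made for few letters only. -/
noncomputable def prune (P : X → Matrix σ σ ℕ) (η : ℝ) (x : X) : Matrix σ σ ℝ :=
  Matrix.of fun a b => if η * Fintype.card X < (Finset.univ.filter fun x => 0 < P x a b).card then
    (P x a b : ℝ) else 0

omit [Fintype σ] [DecidableEq σ] in
theorem prune_nonneg (P : X → Matrix σ σ ℕ) (x : X) (a b : σ) : 0 ≤ prune P η x a b := by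
  simp only [prune, Matrix.of_apply]
  split_ifs
  · exact Nat.cast_nonneg _
  · exact le_rfl

omit [Fintype σ] [DecidableEq σ] in
theorem prune_le (P : X → Matrix σ σ ℕ) (x : X) (a b : σ) : prune P η x a b ≤ P x a b := by
  simp only [prune, Matrix.of_apply]
  split_ifs
  · exact le_rfl
  · exact Nat.cast_nonneg _

open Classical in
/-- The letters with a transition that is made for few letters only. -/
noncomputable def rareLetters (P : X → Matrix σ σ ℕ) (η : ℝ) : Finset X :=
  Finset.univ.filter fun x => ∃ a b, 0 < P x a b ∧
    ((Finset.univ.filter fun x => 0 < P x a b).card : ℝ) ≤ η * Fintype.card X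

omit [DecidableEq σ] in
theorem prune_eq {P : X → Matrix σ σ ℕ} {x : X} (hx : x ∉ rareLetters P η) (a b : σ) :
    prune P η x a b = P x a b := by
  simp only [prune, Matrix.of_apply]
  split_ifs with h
  · rfl
  · by_contra hne
    simp only [rareLetters, Finset.mem_filter, Finset.mem_univ, true_and] at hx
    exact hx ⟨a, b, Nat.pos_of_ne_zero fun h0 => hne (by rw [h0, Nat.cast_zero]), not_lt.1 h⟩

-- A union bound over the pairs of states.
omit [DecidableEq σ] in
theorem card_rareLetters_le (P : X → Matrix σ σ ℕ) (hη : 0 ≤ η) :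
    ((rareLetters P η).card : ℝ) ≤ Fintype.card σ ^ 2 * (η * Fintype.card X) := by
  classical
  let T : σ × σ → Finset X := fun e =>
    if ((Finset.univ.filter fun x => 0 < P x e.1 e.2).card : ℝ) ≤ η * Fintype.card X then
      Finset.univ.filter fun x => 0 < P x e.1 e.2 else ∅
  have hsub : rareLetters P η ⊆ Finset.univ.biUnion T := by
    intro x hx
    obtain ⟨-, a, b, h1, h2⟩ := Finset.mem_filter.1 hx
    refine Finset.mem_biUnion.2 ⟨(a, b), Finset.mem_univ _, ?_⟩
    simp only [T]
    rw [if_pos (by convert h2)]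
    exact Finset.mem_filter.2 ⟨Finset.mem_univ _, h1⟩
  have hT : ∀ e, ((T e).card : ℝ) ≤ η * Fintype.card X := by
    intro e
    simp only [T]
    split_ifs with h
    · exact h
    · simpa using mul_nonneg hη (Nat.cast_nonneg _)
  calc ((rareLetters P η).card : ℝ) ≤ ((Finset.univ.biUnion T).card : ℝ) := by
        exact_mod_cast Finset.card_le_card hsub
    _ ≤ ∑ e, ((T e).card : ℝ) := by exact_mod_cast Finset.card_biUnion_le
    _ ≤ ∑ _e : σ × σ, η * Fintype.card X := Finset.sum_le_sum fun e _ => hT e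
    _ = _ := by
        rw [Finset.sum_const, Finset.card_univ, Fintype.card_prod, nsmul_eq_mul]
        push_cast
        ring

/-- The signed measure that is nonnegative on the large rectangles. -/
noncomputable def signed (D : HardPair X I η) (w : X × X) : ℝ :=
  D.one w.1 w.2 - 1 / 16 * D.zero w.1 w.2

/-- The sum of both measures. -/
noncomputable def total (D : HardPair X I η) (w : X × X) : ℝ := D.one w.1 w.2 + D.zero w.1 w.2

variable (D : HardPair X I η)

theorem total_nonneg (w : X × X) : 0 ≤ D.total w :=
  add_nonneg (D.one_nonneg _ _) (D.zero_nonneg _ _)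

theorem abs_signed_le (w : X × X) : |D.signed w| ≤ D.total w := by
  have h1 := D.one_nonneg w.1 w.2
  have h2 := D.zero_nonneg w.1 w.2
  rw [abs_le, signed, total]
  constructor <;> linarith

theorem sum_total_le : ∑ w, D.total w ≤ 2 := by
  simp only [total, Fintype.sum_prod_type, Finset.sum_add_distrib, D.sum_one]
  linarith [D.sum_zero_le]

theorem sum_signed_mem : ∑ w, D.signed w ∈ Set.Icc (0 : ℝ) (31 / 32) := by
  simp only [signed, Fintype.sum_prod_type, Finset.sum_sub_distrib, D.sum_one, ← Finset.mul_sum]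
  constructor <;> linarith [D.sum_zero_le, D.half_le_sum_zero]

-- For each middle state `c` the product of pruned entries is either zero or the indicator of a
-- large rectangle, so `D.rectangle` applies.
omit [DecidableEq σ] in
theorem sum_signed_smul_nonneg (P : X → Matrix σ σ ℕ) (hP : ∀ x a b, P x a b ≤ 1) (a b : σ) :
    0 ≤ (∑ w : X × X, D.signed w • (prune P η w.1 * prune P η w.2)) a b := by
  classical
  have h1 : (∑ w : X × X, D.signed w • (prune P η w.1 * prune P η w.2)) a b =
      ∑ c, ∑ x, ∑ y, D.signed (x, y) * (prune P η x a c * prune P η y c b) := by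
    rw [Matrix.sum_apply, Fintype.sum_prod_type]
    simp only [Matrix.smul_apply, Matrix.mul_apply, smul_eq_mul, Finset.mul_sum]
    rw [Finset.sum_congr rfl fun x _ => Finset.sum_comm, Finset.sum_comm]
  rw [h1]
  refine Finset.sum_nonneg fun c _ => ?_
  let A : σ → σ → Finset X := fun a b => Finset.univ.filter fun x => 0 < P x a b
  have hpr : ∀ x a b, prune P η x a b = if η * Fintype.card X < (A a b).card then
      (if x ∈ A a b then 1 else 0) else 0 := by
    intro x a b
    have : (P x a b : ℝ) = if x ∈ A a b then 1 else 0 := by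
      have h2 := hP x a b
      split_ifs with h
      · have := (Finset.mem_filter.1 h).2
        exact_mod_cast (by omega : P x a b = 1)
      · have : ¬ 0 < P x a b := fun h' => h (Finset.mem_filter.2 ⟨Finset.mem_univ _, h'⟩)
        exact_mod_cast (by omega : P x a b = 0)
    simp only [prune, Matrix.of_apply, this]
    congr
  simp only [hpr]
  by_cases h2 : η * Fintype.card X < (A a c).card
  · by_cases h3 : η * Fintype.card X < (A c b).card
    · have h4 := D.rectangle (A a c) (A c b) h2 h3
      have h5 : ∑ x, ∑ y, D.signed (x, y) * ((if x ∈ A a c then 1 else 0) *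
          (if y ∈ A c b then 1 else 0)) = ∑ x ∈ A a c, ∑ y ∈ A c b, D.signed (x, y) := by
        have hite : ∀ (C : Finset X) (u : X → ℝ),
            ∑ x ∈ C, u x = ∑ x, if x ∈ C then u x else 0 := fun C u => by
          rw [Finset.sum_ite_mem, Finset.univ_inter]
        rw [hite (A a c)]
        refine Finset.sum_congr rfl fun x _ => ?_
        split_ifs
        · rw [hite (A c b)]
          refine Finset.sum_congr rfl fun y _ => ?_
          split_ifs <;> simp
        · simp
      simp only [h2, h3, if_true]
      rw [h5]
      simp only [signed, Finset.sum_sub_distrib, ← Finset.mul_sum]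
      linarith
    · simp [h3]
  · simp [h2]

open Classical in
omit [DecidableEq σ] in
theorem sum_total_rare_le [Nonempty X] (P : X → Matrix σ σ ℕ) (hη : 0 ≤ η) :
    ∑ w, D.total w *
      ((if w.1 ∈ rareLetters P η then 1 else 0) + (if w.2 ∈ rareLetters P η then 1 else 0)) ≤
        4 * Fintype.card σ ^ 2 * η := by
  have hX : (0 : ℝ) < Fintype.card X := Nat.cast_pos.2 Fintype.card_pos
  have hcard : ((rareLetters P η).card : ℝ) * (2 / Fintype.card X) ≤
      2 * Fintype.card σ ^ 2 * η := by
    refine (mul_le_mul_of_nonneg_right (card_rareLetters_le P hη) (by positivity)).trans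
      (le_of_eq ?_)
    field_simp
  have hrow : ∀ x, ∑ y, D.total (x, y) ≤ 2 / Fintype.card X := by
    intro x
    simp only [total, Finset.sum_add_distrib]
    refine (add_le_add (D.one_row x) (D.zero_row x)).trans (le_of_eq ?_)
    ring
  have hcol : ∀ y, ∑ x, D.total (x, y) ≤ 2 / Fintype.card X := by
    intro y
    simp only [total, Finset.sum_add_distrib]
    refine (add_le_add (D.one_col y) (D.zero_col y)).trans (le_of_eq ?_)
    ring
  simp only [mul_add, Finset.sum_add_distrib, Fintype.sum_prod_type]
  have h1 : ∑ x, ∑ y, D.total (x, y) * (if x ∈ rareLetters P η then 1 else 0) ≤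
      2 * Fintype.card σ ^ 2 * η := by
    calc _ = ∑ x ∈ rareLetters P η, ∑ y, D.total (x, y) := by
          rw [← Finset.univ_inter (rareLetters P η), ← Finset.sum_ite_mem]
          refine Finset.sum_congr rfl fun x _ => ?_
          rw [← Finset.sum_mul]
          split_ifs <;> simp_all
      _ ≤ (rareLetters P η).card • (2 / (Fintype.card X : ℝ)) :=
          Finset.sum_le_card_nsmul _ _ _ fun x _ => hrow x
      _ ≤ _ := by rwa [nsmul_eq_mul]
  have h2 : ∑ x, ∑ y, D.total (x, y) * (if y ∈ rareLetters P η then 1 else 0) ≤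
      2 * Fintype.card σ ^ 2 * η := by
    rw [Finset.sum_comm]
    calc _ = ∑ y ∈ rareLetters P η, ∑ x, D.total (x, y) := by
          rw [← Finset.univ_inter (rareLetters P η), ← Finset.sum_ite_mem]
          refine Finset.sum_congr rfl fun x _ => ?_
          rw [← Finset.sum_mul]
          split_ifs <;> simp_all
      _ ≤ (rareLetters P η).card • (2 / (Fintype.card X : ℝ)) :=
          Finset.sum_le_card_nsmul _ _ _ fun x _ => hcol x
      _ ≤ _ := by rwa [nsmul_eq_mul]
  linarith

/-- A weighted sum of run counts cannot separate the `t`-tuples of related pairs from the other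
`t`-tuples of pairs, unless there are many states. -/
theorem one_le_of_separating (D : HardPair X I η) (hη : 0 ≤ η) (P : X → Matrix σ σ ℕ)
    (hP : ∀ x a b, P x a b ≤ 1) (t k : ℕ) (c : σ → σ → ℕ)
    (hbad : ∀ ω : Fin t → X × X, (∃ i, ¬ I (ω i).1 (ω i).2) →
      ∑ a, ∑ b, c a b * (List.ofFn fun i => P (ω i).1 * P (ω i).2).prod a b = k)
    (hgood : ∀ ω : Fin t → X × X, (∀ i, I (ω i).1 (ω i).2) →
      ∑ a, ∑ b, c a b * (List.ofFn fun i => P (ω i).1 * P (ω i).2).prod a b < k) :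
    (1 : ℝ) ≤ k * ((31 / 32) ^ t + t * 2 ^ t * (4 * Fintype.card σ ^ 2 * η)) := by
  classical
  have : Nonempty X := by
    by_contra h
    rw [not_nonempty_iff] at h
    have := D.sum_one
    simp at this
  let cast := (Nat.castRingHom ℝ).mapMatrix (m := σ)
  let F : (Fin t → X × X) → Matrix σ σ ℝ := fun ω =>
    (List.ofFn fun i => cast (P (ω i).1 * P (ω i).2)).prod
  let G : (Fin t → X × X) → Matrix σ σ ℝ := fun ω =>
    (List.ofFn fun i => prune P η (ω i).1 * prune P η (ω i).2).prod
  let f : (Fin t → X × X) → ℝ := fun ω => ∑ a, ∑ b, (c a b : ℝ) * F ω a b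
  let g : (Fin t → X × X) → ℝ := fun ω => ∑ a, ∑ b, (c a b : ℝ) * G ω a b
  have hF : ∀ ω a b, F ω a b =
      (((List.ofFn fun i => P (ω i).1 * P (ω i).2).prod a b : ℕ) : ℝ) := by
    intro ω a b
    have h1 : cast (List.ofFn fun i => P (ω i).1 * P (ω i).2).prod = F ω := by
      rw [map_list_prod, List.map_ofFn]
      rfl
    rw [← h1]
    rfl
  have hf : ∀ ω, f ω = ((∑ a, ∑ b,
      c a b * (List.ofFn fun i => P (ω i).1 * P (ω i).2).prod a b : ℕ) : ℝ) := by
    intro ω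
    simp only [f, hF]
    push_cast
    rfl
  have hfactor : ∀ (x y : X) (a b : σ), 0 ≤ (prune P η x * prune P η y) a b ∧
      (prune P η x * prune P η y) a b ≤ cast (P x * P y) a b := by
    intro x y a b
    have h1 : cast (P x * P y) a b = ∑ e, (P x a e : ℝ) * P y e b := by
      rw [map_mul, Matrix.mul_apply]
      rfl
    rw [h1, Matrix.mul_apply]
    exact ⟨Finset.sum_nonneg fun e _ => mul_nonneg (prune_nonneg P x a e) (prune_nonneg P y e b),
      Finset.sum_le_sum fun e _ => mul_le_mul (prune_le P x a e) (prune_le P y e b)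
        (prune_nonneg P y e b) (Nat.cast_nonneg _)⟩
  have hGF : ∀ ω a b, 0 ≤ G ω a b ∧ G ω a b ≤ F ω a b := fun ω a b =>
    ofFn_prod_mono _ _ (fun i a b => (hfactor _ _ a b).1) (fun i a b => (hfactor _ _ a b).2) a b
  have hg0 : ∀ ω, 0 ≤ g ω := fun ω => Finset.sum_nonneg fun a _ => Finset.sum_nonneg fun b _ =>
    mul_nonneg (Nat.cast_nonneg _) (hGF ω a b).1
  have hgf : ∀ ω, g ω ≤ f ω := fun ω => Finset.sum_le_sum fun a _ => Finset.sum_le_sum fun b _ =>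
    mul_le_mul_of_nonneg_left (hGF ω a b).2 (Nat.cast_nonneg _)
  let E : X × X → ℝ := fun w =>
    (if w.1 ∈ rareLetters P η then 1 else 0) + (if w.2 ∈ rareLetters P η then 1 else 0)
  have hE : ∀ w, 0 ≤ E w := by
    intro w
    simp only [E]
    split_ifs <;> norm_num
  -- The product structure turns this into a nonnegative combination of entries of the `t`-th power
  -- of a nonnegative matrix.
  have hnonneg : 0 ≤ ∑ ω : Fin t → X × X, (∏ i, D.signed (ω i)) * g ω := by
    have h1 : ∑ ω : Fin t → X × X, (∏ i, D.signed (ω i)) * g ω =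
        ∑ a, ∑ b, (c a b : ℝ) *
          ((∑ w : X × X, D.signed w • (prune P η w.1 * prune P η w.2)) ^ t) a b := by
      rw [← sum_prod_smul_ofFn_prod]
      simp only [Matrix.sum_apply, Matrix.smul_apply, smul_eq_mul, g, Finset.mul_sum]
      rw [Finset.sum_comm]
      refine Finset.sum_congr rfl fun a _ => ?_
      rw [Finset.sum_comm]
      refine Finset.sum_congr rfl fun b _ => Finset.sum_congr rfl fun ω _ => ?_
      ring
    rw [h1]
    exact Finset.sum_nonneg fun a _ => Finset.sum_nonneg fun b _ => mul_nonneg (Nat.cast_nonneg _)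
      (Matrix.pow_apply_nonneg (D.sum_signed_smul_nonneg P hP) t a b)
  -- On tuples of related pairs `k - g ≥ 1` and the signed measure is `one`. On the others `g = k`
  -- unless a letter is rare, and then the loss is at most `k` times the total measure.
  have hpoint : ∀ ω : Fin t → X × X, (∏ i, D.one (ω i).1 (ω i).2) -
      k * ∑ i, (∏ j, D.total (ω j)) * E (ω i) ≤ (∏ i, D.signed (ω i)) * (k - g ω) := by
    intro ω
    have htot : 0 ≤ ∏ j, D.total (ω j) := Finset.prod_nonneg fun j _ => D.total_nonneg _
    have herr : 0 ≤ (k : ℝ) * ∑ i, (∏ j, D.total (ω j)) * E (ω i) :=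
      mul_nonneg (Nat.cast_nonneg _) (Finset.sum_nonneg fun i _ => mul_nonneg htot (hE _))
    by_cases hI : ∀ i, I (ω i).1 (ω i).2
    · have h1 : ∏ i, D.signed (ω i) = ∏ i, D.one (ω i).1 (ω i).2 :=
        Finset.prod_congr rfl fun i _ => by rw [signed, D.zero_eq_zero _ _ (hI i)]; ring
      have h2 : (1 : ℝ) ≤ k - g ω := by
        have h3 : f ω + 1 ≤ k := by
          rw [hf]
          exact_mod_cast hgood ω hI
        linarith [hgf ω]
      have h4 : 0 ≤ ∏ i, D.one (ω i).1 (ω i).2 := Finset.prod_nonneg fun i _ => D.one_nonneg _ _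
      rw [h1]
      nlinarith
    · push Not at hI
      have h1 : ∏ i, D.one (ω i).1 (ω i).2 = 0 := by
        obtain ⟨i, hi⟩ := hI
        exact Finset.prod_eq_zero (Finset.mem_univ i) (D.one_eq_zero _ _ hi)
      have hfk : f ω = k := by
        rw [hf, hbad ω hI]
      rw [h1, zero_sub]
      by_cases hr : ∀ i, (ω i).1 ∉ rareLetters P η ∧ (ω i).2 ∉ rareLetters P η
      · have hgk : g ω = k := by
          rw [← hfk]
          have : G ω = F ω := by
            simp only [G, F]
            congr 2
            funext i
            ext a b
            rw [map_mul, Matrix.mul_apply, Matrix.mul_apply]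
            refine Finset.sum_congr rfl fun e _ => ?_
            rw [prune_eq (hr i).1, prune_eq (hr i).2]
            rfl
          simp only [g, f, this]
        rw [hgk, sub_self, mul_zero]
        linarith
      · have hex : ∃ i, 1 ≤ E (ω i) := by
          by_contra! hlt
          refine hr fun i => ?_
          have := hlt i
          simp only [E] at this
          constructor
          · intro h
            rw [if_pos h] at this
            split_ifs at this <;> norm_num at this
          · intro h
            rw [if_pos h] at this
            split_ifs at this <;> norm_num at this
        obtain ⟨i, hi⟩ := hex
        have h2 : ∏ j, D.total (ω j) ≤ ∑ i, (∏ j, D.total (ω j)) * E (ω i) := by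
          refine le_trans ?_ (Finset.single_le_sum
            (fun i _ => mul_nonneg htot (hE (ω i))) (Finset.mem_univ i))
          exact le_mul_of_one_le_right htot hi
        have h3 : |∏ i, D.signed (ω i)| ≤ ∏ j, D.total (ω j) := by
          rw [Finset.abs_prod]
          exact Finset.prod_le_prod (fun _ _ => abs_nonneg _) fun i _ => D.abs_signed_le _
        have h4 : |(∏ i, D.signed (ω i)) * (k - g ω)| ≤ (∏ j, D.total (ω j)) * k := by
          rw [abs_mul]
          refine mul_le_mul h3 ?_ (abs_nonneg _) htot
          rw [abs_of_nonneg (by linarith [hgf ω])]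
          linarith [hg0 ω]
        have h5 := neg_abs_le ((∏ i, D.signed (ω i)) * (k - g ω))
        have h6 := mul_le_mul_of_nonneg_left h2 (Nat.cast_nonneg (α := ℝ) k)
        linarith
  have hsum := Finset.sum_le_sum fun ω (_ : ω ∈ Finset.univ) => hpoint ω
  have hone : ∑ ω : Fin t → X × X, ∏ i, D.one (ω i).1 (ω i).2 = 1 := by
    rw [← Fintype.sum_pow (fun w : X × X => D.one w.1 w.2), Fintype.sum_prod_type, D.sum_one,
      one_pow]
  have herr : ∑ ω : Fin t → X × X, ∑ i, (∏ j, D.total (ω j)) * E (ω i) ≤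
      t * (2 ^ t * (4 * Fintype.card σ ^ 2 * η)) := by
    rw [Finset.sum_comm]
    refine (Finset.sum_le_card_nsmul _ _ (2 ^ t * (4 * Fintype.card σ ^ 2 * η)) fun i _ => ?_).trans
      (le_of_eq (by simp))
    refine (sum_prod_mul_indicator_le D.total D.total_nonneg D.sum_total_le E hE i).trans ?_
    exact mul_le_mul_of_nonneg_left (D.sum_total_rare_le P hη) (by positivity)
  have hpow : (∑ w, D.signed w) ^ t ≤ (31 / 32) ^ t :=
    pow_le_pow_left₀ D.sum_signed_mem.1 D.sum_signed_mem.2 t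
  rw [Finset.sum_sub_distrib, hone, ← Finset.mul_sum] at hsum
  have hsplit : ∑ ω : Fin t → X × X, (∏ i, D.signed (ω i)) * (k - g ω) =
      (∑ w, D.signed w) ^ t * k - ∑ ω : Fin t → X × X, (∏ i, D.signed (ω i)) * g ω := by
    rw [Fintype.sum_pow, Finset.sum_mul, ← Finset.sum_sub_distrib]
    exact Finset.sum_congr rfl fun ω _ => by ring
  rw [hsplit] at hsum
  have hk : (0 : ℝ) ≤ k := Nat.cast_nonneg _
  have h1 := mul_le_mul_of_nonneg_left herr hk
  have h2 := mul_le_mul_of_nonneg_right hpow hk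
  nlinarith

end HardPair

/-! ### From automata to separating weights. -/

section Words

variable {α σ : Type*} [Fintype σ] [DecidableEq σ]

theorem NFA.lift_stepMatrix (N : NFA α σ) (u : FreeMonoid α) :
    FreeMonoid.lift N.stepMatrix u = N.runMatrix u.toList := by
  rw [FreeMonoid.lift_apply, runMatrix]

/-- The run matrices of an automaton of sublinear ambiguity. -/
noncomputable def NFA.slowRep (N : NFA α σ) (hN : N.HasSublinearAmbiguity) :
    SlowRep (FreeMonoid α) σ where
  M := FreeMonoid.lift N.stepMatrix
  len := FreeMonoid.length
  useful := {c | (∃ u, ∃ s ∈ N.start, 0 < FreeMonoid.lift N.stepMatrix u s c) ∧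
    ∃ v, ∃ f ∈ N.accept, 0 < FreeMonoid.lift N.stepMatrix v c f}
  len_mul u v := FreeMonoid.length_mul u v
  convex := by
    rintro a b c u v ⟨⟨x, s, hs, hx⟩, -⟩ ⟨-, y, f, hf, hy⟩ hu hv
    refine ⟨⟨x * u, s, hs, ?_⟩, v * y, f, hf, ?_⟩
    · rw [map_mul, Matrix.mul_apply_pos_iff]
      exact ⟨a, hx, hu⟩
    · rw [map_mul, Matrix.mul_apply_pos_iff]
      exact ⟨b, hv, hy⟩
  slow := by
    intro c hc C
    let M := FreeMonoid.lift N.stepMatrix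
    -- Fixed words lead from the start to each useful state, and from it to acceptance; `1` is a
    -- dummy for the other states.
    have hl : ∀ p, ∃ u, (∃ v, ∃ s ∈ N.start, 0 < M v s p) → ∃ s ∈ N.start, 0 < M u s p := by
      intro p
      by_cases h : ∃ v, ∃ s ∈ N.start, 0 < M v s p
      · exact ⟨h.choose, fun _ => h.choose_spec⟩
      · exact ⟨1, fun h' => absurd h' h⟩
    have hr : ∀ p, ∃ u, (∃ v, ∃ f ∈ N.accept, 0 < M v p f) → ∃ f ∈ N.accept, 0 < M u p f := by
      intro p
      by_cases h : ∃ v, ∃ f ∈ N.accept, 0 < M v p f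
      · exact ⟨h.choose, fun _ => h.choose_spec⟩
      · exact ⟨1, fun h' => absurd h' h⟩
    choose l hl using hl
    choose r hr using hr
    set D : ℕ := ∑ p, (l p).length + ∑ p, (r p).length with hD
    -- Half of `c * m` pays for the part of the length proportional to `m`, the other half for the
    -- constants.
    set δ : ℝ := c / (2 * (C + 1)) with hδ
    have hδ0 : 0 < δ := by positivity
    obtain ⟨B, hB⟩ := hN.exists_bound hδ0
    obtain ⟨m, hm⟩ := exists_nat_gt ((δ * (D + C) + B) / (c / 2))
    rw [div_lt_iff₀ (by positivity)] at hm
    refine ⟨m, fun u hu p hp q hq => ?_⟩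
    obtain ⟨s, hs, hsp⟩ := hl p hp.1
    obtain ⟨f, hf, hqf⟩ := hr q hq.2
    have h1 : M u p q ≤ N.ambigWord (l p * u * r q).toList := by
      refine le_trans ?_ (N.runMatrix_le_ambigWord _ hs hf)
      rw [← N.lift_stepMatrix, map_mul, map_mul]
      have h2 := Matrix.apply_mul_apply_le_mul_apply (M (l p)) (M u) s q p
      have h3 := Matrix.apply_mul_apply_le_mul_apply (M (l p) * M u) (M (r q)) s f q
      refine le_trans ?_ (le_trans (Nat.mul_le_mul_right _ h2) h3)
      refine le_trans (Nat.le_mul_of_pos_left _ hsp) (Nat.le_mul_of_pos_right _ hqf)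
    have h2 : ((l p * u * r q).toList.length : ℝ) ≤ D + C * (m + 1) := by
      have h3 : (l p * u * r q).toList.length = (l p).length + u.length + (r q).length := by
        simp only [FreeMonoid.toList_mul, List.length_append]
        rfl
      have h4 := Finset.single_le_sum (f := fun p => (l p).length) (fun _ _ => Nat.zero_le _)
        (Finset.mem_univ p)
      have h5 := Finset.single_le_sum (f := fun p => (r p).length) (fun _ _ => Nat.zero_le _)
        (Finset.mem_univ q)
      have h6 : (l p * u * r q).toList.length ≤ D + C * (m + 1) := by
        rw [h3]
        omega
      exact_mod_cast h6
    have h3 := hB (l p * u * r q).toList.length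
    have h4 : (M u p q : ℝ) ≤ N.ambig (l p * u * r q).toList.length := by
      exact_mod_cast h1.trans (N.ambigWord_le_ambig _)
    have h5 := mul_le_mul_of_nonneg_left h2 hδ0.le
    have h6 : δ * C * m ≤ c / 2 * m := by
      refine mul_le_mul_of_nonneg_right ?_ (Nat.cast_nonneg m)
      rw [hδ, div_mul_eq_mul_div, div_le_div_iff₀ (by positivity) (by norm_num)]
      nlinarith
    have h7 : δ * (D + C * (m + 1)) = δ * (D + C) + δ * C * m := by ring
    change (M u p q : ℝ) < c * m
    linarith

theorem NFA.slowRep_M (N : NFA α σ) (hN : N.HasSublinearAmbiguity) (u : FreeMonoid α) :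
    (N.slowRep hN).M u = N.runMatrix u.toList :=
  N.lift_stepMatrix u

theorem eq_of_flatten_eq_of_length {ℓ : ℕ} (hℓ : 0 < ℓ) {bs cs : List (List α)}
    (hb : ∀ b ∈ bs, b.length = ℓ) (hc : ∀ b ∈ cs, b.length = ℓ) (h : bs.flatten = cs.flatten) :
    bs = cs := by
  refine List.eq_iff_flatten_eq.2 ⟨h, ?_⟩
  have h1 := congrArg List.length h
  rw [length_flatten_of_forall hb, length_flatten_of_forall hc] at h1
  rw [List.map_eq_replicate_iff.2 hb, List.map_eq_replicate_iff.2 hc,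
    Nat.eq_of_mul_eq_mul_right hℓ h1]

/-- The concatenations of blocks of length `ℓ` that are not in `L`. -/
def avoiding (ℓ : ℕ) (L : Language α) : Submonoid (FreeMonoid α) where
  carrier := {w | ∃ bs : List (List α), w.toList = bs.flatten ∧ ∀ b ∈ bs, b.length = ℓ ∧ b ∉ L}
  one_mem' := ⟨[], rfl, by simp⟩
  mul_mem' := by
    rintro u v ⟨bs, hbs, hb⟩ ⟨cs, hcs, hc⟩
    refine ⟨bs ++ cs, ?_, ?_⟩
    · rw [FreeMonoid.toList_mul, hbs, hcs, List.flatten_append]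
    · intro b hbc
      rcases List.mem_append.1 hbc with h | h
      · exact hb b h
      · exact hc b h

/-- Blocks of a fixed positive length are determined by the word. -/
theorem notMem_existsOne_of_mem_avoiding {ℓ : ℕ} (hℓ : 0 < ℓ) {L : Language α} {w : FreeMonoid α}
    (hw : w ∈ avoiding ℓ L) : w.toList ∉ existsOne ℓ L := by
  obtain ⟨bs, hbs, hb⟩ := hw
  rintro ⟨cs, hcs, hc, b, hbc, hbL⟩
  have := eq_of_flatten_eq_of_length hℓ (fun b h => (hb b h).1) hc (hbs.symm.trans hcs)
  subst this
  exact (hb b hbc).2 hbL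

theorem mem_existsOne_of_mem_avoiding {ℓ : ℕ} {L : Language α} {u v : FreeMonoid α} {b : List α}
    (hu : u ∈ avoiding ℓ L) (hv : v ∈ avoiding ℓ L) (hb : b ∈ L) (hlen : b.length = ℓ) :
    (u * FreeMonoid.ofList b * v).toList ∈ existsOne ℓ L := by
  obtain ⟨bs, hbs, h1⟩ := hu
  obtain ⟨cs, hcs, h2⟩ := hv
  refine ⟨bs ++ b :: cs, ?_, ?_, b, by simp, hb⟩
  · simp [FreeMonoid.toList_mul, hbs, hcs]
  · intro x hx
    rcases List.mem_append.1 hx with h | h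
    · exact (h1 x h).1
    · rcases List.mem_cons.1 h with rfl | h
      · exact hlen
      · exact (h2 x h).1

/-- For an automaton of sublinear ambiguity that recognizes `∃₁(L)`, some weighted sum of run counts
separates the blocks in `L` from the other blocks. -/
theorem NFA.exists_separating_weights (N : NFA α σ) {ℓ : ℕ} (hℓ : 0 < ℓ) {L : Language α}
    (hL : N.accepts = existsOne ℓ L) (hN : N.HasSublinearAmbiguity) :
    ∃ (k : ℕ) (c : σ → σ → ℕ), k ≤ Fintype.card σ ∧
      (∀ w : List α, w.length = ℓ → w ∉ L → ∑ a, ∑ b, c a b * N.runMatrix w a b = k) ∧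
      ∀ w : List α, w.length = ℓ → w ∈ L → ∑ a, ∑ b, c a b * N.runMatrix w a b < k := by
  obtain ⟨z, k, R, hz, hk, hbad, hgood⟩ := (N.slowRep hN).exists_separating_sum (avoiding ℓ L)
  refine ⟨k, fun x y => ∑ a, ∑ b, R a b * (N.runMatrix z.toList a x * N.runMatrix z.toList y b),
    hk, ?_⟩
  have hsum : ∀ w : List α, ∑ x, ∑ y,
      (∑ a, ∑ b, R a b * (N.runMatrix z.toList a x * N.runMatrix z.toList y b)) *
        N.runMatrix w x y =
      ∑ a, ∑ b, R a b * (N.slowRep hN).M (z * FreeMonoid.ofList w * z) a b := by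
    intro w
    simp only [map_mul, NFA.slowRep_M, FreeMonoid.toList_ofList, Matrix.mul_apply, Finset.mul_sum,
      Finset.sum_mul]
    rw [Finset.sum_congr rfl fun x _ => Finset.sum_comm, Finset.sum_comm]
    refine Finset.sum_congr rfl fun a _ => ?_
    rw [Finset.sum_congr rfl fun x _ => Finset.sum_comm, Finset.sum_comm]
    refine Finset.sum_congr rfl fun b _ => ?_
    rw [Finset.sum_comm]
    refine Finset.sum_congr rfl fun y _ => Finset.sum_congr rfl fun x _ => ?_
    ring
  simp only [hsum]
  constructor
  · intro w hlen hw
    exact hbad _ ⟨[w], by simp, by simpa using ⟨hlen, hw⟩⟩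
  · intro w hlen hw
    have h1 : (z * FreeMonoid.ofList w * z).toList ∈ N.accepts :=
      hL ▸ mem_existsOne_of_mem_avoiding hz hz hw hlen
    obtain ⟨s, hs, f, hf, hpos⟩ := NFA.mem_accepts_iff_runMatrix.1 h1
    rw [← N.slowRep_M hN] at hpos
    refine hgood _ s ⟨⟨1, s, hs, by simp⟩, _, f, hf, hpos⟩ f ⟨⟨_, s, hs, hpos⟩, 1, f, hf, by simp⟩
      ?_ hpos
    intro u hu
    by_contra hne
    refine notMem_existsOne_of_mem_avoiding hℓ hu ?_
    rw [← hL]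
    refine NFA.mem_accepts_iff_runMatrix.2 ⟨s, hs, f, hf, ?_⟩
    rw [← N.slowRep_M hN]
    exact Nat.pos_of_ne_zero hne

end Words

/-! ### The lower bound for the concrete language. -/

section Pairs

variable {A U : Type*} {mem : U → A → Prop}

theorem ofFn_flatten_mem_commonPairs_pow {t : ℕ} (p : Fin t → A × A) :
    (List.ofFn fun i => [(p i).1, (p i).2]).flatten ∈ commonPairs mem ^ t ↔
      ∀ i, ∃ u, mem u (p i).1 ∧ mem u (p i).2 := by
  induction t with
  | zero => simp [Language.mem_one]
  | succ t ih =>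
    rw [List.ofFn_succ, List.flatten_cons, pow_succ', Language.mem_mul, Fin.forall_fin_succ,
      ← ih fun i => p i.succ]
    constructor
    · rintro ⟨_, ⟨x, y, u, rfl, hx, hy⟩, b, hb, h⟩
      simp only [List.cons_append, List.nil_append, List.cons.injEq] at h
      obtain ⟨rfl, rfl, rfl⟩ := h
      exact ⟨⟨u, hx, hy⟩, hb⟩
    · rintro ⟨⟨u, hx, hy⟩, hb⟩
      exact ⟨_, ⟨_, _, u, rfl, hx, hy⟩, _, hb, rfl⟩

end Pairs

/-- The subset with the elements `j * r ^ 31 + x j`, as a letter. -/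
def graphLetter {r : ℕ} (x : Fin r → Fin (r ^ 31)) : SubsetLetter r :=
  ⟨Finset.univ.image fun j => (finProdFinEquiv.trans (finCongr (by ring : r * r ^ 31 = r ^ 32)))
    (j, x j), by
    rw [Finset.card_image_of_injective]
    · simp
    · intro i j h
      exact congrArg Prod.fst ((Equiv.injective _) h)⟩

theorem exists_mem_graphLetter_iff {r : ℕ} {x y : Fin r → Fin (r ^ 31)} :
    (∃ u, u ∈ (graphLetter x).1 ∧ u ∈ (graphLetter y).1) ↔ ∃ j, x j = y j := by
  constructor
  · rintro ⟨u, hx, hy⟩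
    obtain ⟨i, -, rfl⟩ := Finset.mem_image.1 hx
    obtain ⟨j, -, h⟩ := Finset.mem_image.1 hy
    have h' := (Equiv.injective _) h
    obtain rfl : j = i := congrArg Prod.fst h'
    exact ⟨j, (congrArg Prod.snd h').symm⟩
  · rintro ⟨j, h⟩
    exact ⟨_, Finset.mem_image_of_mem _ (Finset.mem_univ j),
      Finset.mem_image.2 ⟨j, Finset.mem_univ j, by rw [h]⟩⟩

theorem one_le_of_sublinear {r t : ℕ} (hr : 2 ≤ r) (ht : 0 < t) {σ : Type*} [Fintype σ]
    (N : NFA (SubsetLetter r) σ) (hL : N.accepts = existsOne (2 * t) (nonDisj r ^ t))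
    (hN : N.HasSublinearAmbiguity) :
    ∃ k : ℕ, k ≤ Fintype.card σ ∧ (1 : ℝ) ≤ k * ((31 / 32) ^ t +
      t * 2 ^ t * (4 * Fintype.card σ ^ 2 * Real.exp (-((r : ℝ) / 160)))) := by
  classical
  obtain ⟨k, c, hk, hbad, hgood⟩ := N.exists_separating_weights (by omega) hL hN
  refine ⟨k, hk, ?_⟩
  have hne : NeZero r := ⟨by omega⟩
  have hcard : 2 * Fintype.card (Fin r) ≤ Fintype.card (Fin (r ^ 31)) := by
    simp only [Fintype.card_fin]
    calc 2 * r ≤ r ^ 30 * r := Nat.mul_le_mul_right _ (by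
          calc 2 ≤ r := hr
            _ = r ^ 1 := (pow_one r).symm
            _ ≤ r ^ 30 := Nat.pow_le_pow_right (by omega) (by norm_num))
      _ = r ^ 31 := by ring
  let D := hardPair hcard
  let word : (Fin t → (Fin r → Fin (r ^ 31)) × (Fin r → Fin (r ^ 31))) → List (SubsetLetter r) :=
    fun ω => (List.ofFn fun i => [graphLetter (ω i).1, graphLetter (ω i).2]).flatten
  have hword : ∀ ω, word ω ∈ nonDisj r ^ t ↔ ∀ i, ∃ j, (ω i).1 j = (ω i).2 j := by
    intro ω
    rw [nonDisj_eq_commonPairs]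
    refine (ofFn_flatten_mem_commonPairs_pow
      fun i => (graphLetter (ω i).1, graphLetter (ω i).2)).trans ?_
    simp only [exists_mem_graphLetter_iff]
  have hlen : ∀ ω, (word ω).length = 2 * t := by
    intro ω
    rw [length_flatten_of_forall (ℓ := 2)]
    · rw [List.length_ofFn, mul_comm]
    · intro b hb
      obtain ⟨i, rfl⟩ := List.mem_ofFn.1 hb
      rfl
  have hrun : ∀ ω, N.runMatrix (word ω) = (List.ofFn fun i =>
      N.stepMatrix (graphLetter (ω i).1) * N.stepMatrix (graphLetter (ω i).2)).prod := by
    intro ω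
    rw [NFA.runMatrix, List.map_flatten, List.prod_flatten, List.map_map, List.map_ofFn]
    congr 2
    funext i
    simp
  have h := D.one_le_of_separating (Real.exp_pos _).le (fun x => N.stepMatrix (graphLetter x))
    (fun x a b => by
      simp only [NFA.stepMatrix, Matrix.of_apply]
      split_ifs <;> norm_num) t k c
    (fun ω hω => by
      rw [← hrun]
      exact hbad _ (hlen ω) fun h => by
        obtain ⟨i, hi⟩ := hω
        exact hi ((hword ω).1 h i))
    (fun ω hω => by
      rw [← hrun]
      exact hgood _ (hlen ω) ((hword ω).2 hω))
  simpa using h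

/-- A single state would be both initial and accepting, and the empty word would be accepted. -/
theorem two_le_card_of_accepts {r t : ℕ} (hr : 1 ≤ r) (ht : 0 < t) {σ : Type*} [Fintype σ]
    (N : NFA (SubsetLetter r) σ) (hL : N.accepts = existsOne (2 * t) (nonDisj r ^ t)) :
    2 ≤ Fintype.card σ := by
  classical
  by_contra! hcard
  have hsub : Subsingleton σ := Fintype.card_le_one_iff_subsingleton.1 (by omega)
  have hne : NeZero r := ⟨by omega⟩
  let a : SubsetLetter r := graphLetter fun _ => ⟨0, Nat.pos_of_ne_zero (pow_ne_zero _ hne.ne)⟩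
  let w : List (SubsetLetter r) := (List.ofFn fun _ : Fin t => [a, a]).flatten
  have hw : w ∈ nonDisj r ^ t := by
    rw [nonDisj_eq_commonPairs]
    refine (ofFn_flatten_mem_commonPairs_pow fun _ => (a, a)).2 fun _ => ?_
    exact exists_mem_graphLetter_iff.2 ⟨0, rfl⟩
  have hlen : ∀ b ∈ nonDisj r ^ t, b.length = 2 * t := by
    rw [nonDisj_eq_commonPairs]
    exact fun b hb => length_of_mem_commonPairs_pow hb
  have hacc : w ∈ N.accepts := by
    rw [hL, mem_existsOne_iff hlen]
    exact ⟨[], w, [], by simp, by simp, hw, by simp⟩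
  obtain ⟨p, hp, q, hq, -⟩ := NFA.mem_accepts_iff_runMatrix.1 hacc
  have hnil : [] ∈ N.accepts :=
    NFA.mem_accepts_iff_runMatrix.2 ⟨p, hp, p, Subsingleton.elim q p ▸ hq, by simp⟩
  rw [hL, mem_existsOne_iff hlen] at hnil
  obtain ⟨u, v, x, h, -, hv, -⟩ := hnil
  have h1 := congrArg List.length h
  simp only [List.length_append, List.length_nil, hlen v hv] at h1
  omega

/-- If `s < exp (R / 100)`, both summands are at most `exp (-1) < 1 / 2`: the first because the
decay rate `1 / 32` in `t` beats `1 / 100`, the second because `R ^ 3 / 160` outweighs all the terms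
linear in `R`. -/
theorem card_lower_bound {R : ℝ} (hR : 100 ≤ R) {t k s : ℕ} (ht : |(t : ℝ) - R| < 1)
    (hk : k ≤ s) (h : (1 : ℝ) ≤ k * ((31 / 32) ^ t +
      t * 2 ^ t * (4 * (s : ℝ) ^ 2 * Real.exp (-(R ^ 3 / 160))))) :
    Real.exp (1 / 100 * R) ≤ s := by
  by_contra! hs
  obtain ⟨ht1, ht2⟩ := abs_lt.1 ht
  have hexp1 : Real.exp (-1) < 1 / 2 := by
    have := Real.exp_one_gt_d9
    rw [Real.exp_neg, inv_lt_comm₀ (Real.exp_pos 1) (by norm_num)]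
    norm_num
    linarith
  have hks : (k : ℝ) ≤ Real.exp (1 / 100 * R) := (Nat.cast_le.2 hk).trans hs.le
  have h1 : (k : ℝ) * (31 / 32) ^ t ≤ Real.exp (-1) := by
    have h2 : (31 / 32 : ℝ) ^ t ≤ Real.exp (-(1 / 32) * t) := by
      rw [mul_comm, Real.exp_nat_mul]
      refine pow_le_pow_left₀ (by norm_num) ?_ t
      linarith [Real.add_one_le_exp (-(1 / 32 : ℝ))]
    calc (k : ℝ) * (31 / 32) ^ t ≤ Real.exp (1 / 100 * R) * Real.exp (-(1 / 32) * t) :=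
          mul_le_mul hks h2 (by positivity) (Real.exp_pos _).le
      _ = Real.exp (1 / 100 * R + -(1 / 32) * t) := (Real.exp_add _ _).symm
      _ ≤ Real.exp (-1) := Real.exp_le_exp.2 (by linarith)
  have h2 : (k : ℝ) * (t * 2 ^ t * (4 * (s : ℝ) ^ 2 * Real.exp (-(R ^ 3 / 160)))) ≤
      Real.exp (-1) := by
    have h3 : (2 : ℝ) ≤ Real.exp 1 := by linarith [Real.exp_one_gt_d9]
    have h4 : (2 : ℝ) ^ t ≤ Real.exp t := by
      rw [← mul_one (t : ℝ), Real.exp_nat_mul]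
      exact pow_le_pow_left₀ (by norm_num) h3 t
    have h5 : (t : ℝ) ≤ Real.exp t := by linarith [Real.add_one_le_exp (t : ℝ)]
    have h6 : (4 : ℝ) ≤ Real.exp 2 := by
      rw [show (2 : ℝ) = 1 + 1 by norm_num, Real.exp_add]
      nlinarith
    have h7 : (s : ℝ) ^ 2 ≤ Real.exp (1 / 100 * R) ^ 2 :=
      pow_le_pow_left₀ (Nat.cast_nonneg _) hs.le 2
    calc (k : ℝ) * (t * 2 ^ t * (4 * (s : ℝ) ^ 2 * Real.exp (-(R ^ 3 / 160))))
        ≤ Real.exp (1 / 100 * R) * (Real.exp t * Real.exp t *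
          (Real.exp 2 * Real.exp (1 / 100 * R) ^ 2 * Real.exp (-(R ^ 3 / 160)))) := by
          gcongr
      _ = Real.exp (1 / 100 * R + (t + t + (2 + (1 / 100 * R + 1 / 100 * R) +
            -(R ^ 3 / 160)))) := by
          simp only [Real.exp_add]
          ring
      _ ≤ Real.exp (-1) := by
          refine Real.exp_le_exp.2 ?_
          have h8 : 10000 * R ≤ R ^ 3 := by nlinarith [mul_self_nonneg (R - 100)]
          linarith
  rw [mul_add] at h
  linarith

theorem lemma7 :
    (∃ c : ℝ, 0 < c ∧
      ∀ r t : ℕ, 1 ≤ r → |(t : ℝ) - (r : ℝ) ^ (1 / 3 : ℝ)| < 1 →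
        ∀ (σ : Type*) [Fintype σ] (N : NFA (SubsetLetter r) σ),
          N.accepts = existsOne (2 * t) (nonDisj r ^ t) →
          (N.HasSublinearAmbiguity ∨ N.IsFinitelyAmbiguous) →
          (2 : ℝ) ^ (c * (r : ℝ) ^ (1 / 3 : ℝ)) ≤ (Fintype.card σ : ℝ)) ∧
    (∃ C d : ℕ,
      ∀ r t : ℕ, 1 ≤ r → |(t : ℝ) - (r : ℝ) ^ (1 / 3 : ℝ)| < 1 →
        ∃ s : ℕ, s ≤ C * r ^ d ∧
          ∃ N : NFA (SubsetLetter r) (Fin s),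
            (∃ q₀ : Fin s, N.start = {q₀}) ∧
            N.accepts = existsOne (2 * t) (nonDisj r ^ t) ∧
            N.HasLinearAmbiguity) := by
  have hpos : ∀ r t : ℕ, 1 ≤ r → |(t : ℝ) - (r : ℝ) ^ (1 / 3 : ℝ)| < 1 → 0 < t := by
    intro r t hr ht
    have h1 : (1 : ℝ) ≤ (r : ℝ) ^ (1 / 3 : ℝ) :=
      Real.one_le_rpow (by exact_mod_cast hr) (by norm_num)
    have h2 : (0 : ℝ) < t := by linarith [(abs_lt.1 ht).1]
    exact_mod_cast h2
  constructor
  · refine ⟨1 / 100, by norm_num, ?_⟩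
    intro r t hr ht σ _ N hL hN
    have ht0 := hpos r t hr ht
    have hN' : N.HasSublinearAmbiguity := hN.elim id fun h => h.hasSublinearAmbiguity
    set R : ℝ := (r : ℝ) ^ (1 / 3 : ℝ) with hR
    have hR0 : 0 ≤ R := Real.rpow_nonneg (Nat.cast_nonneg r) _
    have hR3 : R ^ 3 = r := by
      rw [hR, ← Real.rpow_natCast, ← Real.rpow_mul (Nat.cast_nonneg r)]
      norm_num
    -- For `R < 100` the exponent `R / 100` is below 1, so two states suffice.
    rcases lt_or_ge R 100 with hsmall | hlarge
    · have h2 : (2 : ℝ) ≤ Fintype.card σ := by exact_mod_cast two_le_card_of_accepts hr ht0 N hL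
      refine le_trans ?_ h2
      calc (2 : ℝ) ^ (1 / 100 * R) ≤ 2 ^ (1 : ℝ) :=
            Real.rpow_le_rpow_of_exponent_le (by norm_num) (by linarith)
        _ = 2 := Real.rpow_one 2
    · have hr2 : 2 ≤ r := by
        by_contra! hlt
        obtain rfl : r = 1 := by omega
        rw [hR] at hlarge
        norm_num at hlarge
      obtain ⟨k, hk, h⟩ := one_le_of_sublinear hr2 ht0 N hL hN'
      rw [← hR3] at h
      refine le_trans ?_ (card_lower_bound hlarge ht hk h)
      rw [Real.rpow_def_of_pos (by norm_num)]
      refine Real.exp_le_exp.2 ?_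
      have hlog : Real.log 2 ≤ 1 := by linarith [Real.log_two_lt_d9]
      exact mul_le_of_le_one_left (by positivity) hlog
  · refine ⟨6, 33, ?_⟩
    intro r t hr ht
    obtain ⟨s, hs, hN⟩ := exists_linear_ambiguity_nfa r t (hpos r t hr ht)
    refine ⟨s, ?_, hN⟩
    have hRr : (r : ℝ) ^ (1 / 3 : ℝ) ≤ r := by
      calc (r : ℝ) ^ (1 / 3 : ℝ) ≤ (r : ℝ) ^ (1 : ℝ) :=
            Real.rpow_le_rpow_of_exponent_le (by exact_mod_cast hr) (by norm_num)
        _ = r := Real.rpow_one _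
    have htr : t ≤ r := by
      have : (t : ℝ) < r + 1 := by linarith [(abs_lt.1 ht).2]
      have : t < r + 1 := by exact_mod_cast this
      omega
    have h1 : r ≤ r ^ 33 := Nat.le_self_pow (by norm_num) r
    calc s = 5 * t + t * r ^ 32 := hs
      _ ≤ 5 * r ^ 33 + r * r ^ 32 :=
          Nat.add_le_add (Nat.mul_le_mul_left _ (htr.trans h1)) (Nat.mul_le_mul_right _ htr)
      _ = 6 * r ^ 33 := by ring
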